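/- **Conventions.** A unitary representation of a topological group $G$ is a strongly continuous homomorphism $\pi:G\to\mathcal U(\mathcal H)$ into the unitary group of a complex Hilbert space. It *has almost invariant vectors* if for every $\varepsilon>0$ and every compact $F\subset G$ there is a unit vector $\xi\in\mathcal H$ with $\|\pi(g)\xi-\xi\|\le\varepsilon$ for all $g\in F$. A continuous homomorphism $q:G\to Q$ with dense image is a *resolution* if for every unitary representation $\pi$ of $G$ with almost invariant vectors there are a closed $\pi$-invariant subspace $\mathcal K$ and a unitary representation $\tilde\sigma$ of $Q$ on $\mathcal K$ with almost invariant vectors such that $\pi(g)|_{\mathcal K}=\tilde\sigma(q(g))$ for all $g\in G$. **Proposition 2.3.** Let $H$ be a locally compact (Hausdorff) abelian group and $A\subset H$ a dense countable subgroup, which is itself regarded as a discrete group. Let $\hat H$ and $\hat A$ be the dual groups (with the compact-open topology) and let $p:\hat H\to\hat A$, $p(\eta)=\eta|_A$, be the map given by restriction of characters. Let $\Gamma$ be a countable discrete group acting on $H$ by continuous automorphisms and leaving $A$ invariant. It acts on $\hat H$ and on $\hat A$ by $(\gamma\cdot\eta)(x)=\eta(\gamma^{-1}x)$. Suppose that the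 inclusion $A\rtimes\Gamma\to H\rtimes\Gamma$ is a resolution, where the semidirect products carry the product topologies (so that $A\rtimes\Gamma$ is discrete). Let $V\subset\hat H$ be a $\Gamma$-invariant neighbourhood of the trivial character $1\in\hat H$. Let $(\mu_n)$ be any sequence of Borel probability measures on $\hat A$ which converges weakly to the Dirac measure $\delta_1$ at the trivial character and satisfies $\lim_{n\to\infty}\|\gamma_*\mu_n-\mu_n\|=0$ for every $\gamma\in\Gamma$, where $\gamma_*\mu_n$ is the image of $\mu_n$ under $\gamma$ and $\|\mu-\nu\|$ is the supremum of $\left|\int f\,d\mu-\int f\,d\nu\right|$ over all Borel functions $f:\hat A\to\mathbb C$ with $\sup|f|\le 1$. Then $$\lim_{n\to\infty}\mu_n(p(V))=1 ,$$ and in particular $\lim_{n\to\infty}\mu_n(p(\hat H))=1$. (If $p(V)$ or $p(\hat H)$ is not a Borel set, its measure is understood as outer measure.) -/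

import Mathlib

open Filter Topology MeasureTheory

universe u v w

noncomputable section

/-! ### Unitary representations, almost invariant vectors, resolutions -/

/-- A (strongly continuous) unitary representation of a topological group `G` on a complex
Hilbert space `E`; `E ≃ₗᵢ[ℂ] E` is the unitary group of `E`. -/
structure UnitaryRep (G : Type*) [Group G] [TopologicalSpace G]
    (E : Type*) [NormedAddCommGroup E] [InnerProductSpace ℂ E] where
  /-- the underlying homomorphism into the unitary group -/
  toHom : G →* (E ≃ₗᵢ[ℂ] E)
  continuous_orbit : ∀ ξ : E, Continuous fun g : G => toHom g ξ

/-- For every `ε > 0` and every compact `F ⊆ G` there is a unit vector moved by at most `ε` by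
all elements of `F`. -/
def UnitaryRep.HasAlmostInvariantVectors {G : Type*} [Group G] [TopologicalSpace G]
    {E : Type*} [NormedAddCommGroup E] [InnerProductSpace ℂ E] (π : UnitaryRep G E) : Prop :=
  ∀ ε : ℝ, 0 < ε → ∀ F : Set G, IsCompact F →
    ∃ ξ : E, ‖ξ‖ = 1 ∧ ∀ g ∈ F, ‖π.toHom g ξ - ξ‖ ≤ ε

/-- A continuous homomorphism `p : G → Q` with dense image is a resolution if every unitary
representation `π` of `G` with almost invariant vectors has a subrepresentation (the restriction
of `π` to a closed invariant subspace `K`) of the form `σ ∘ p`, where `σ` is a unitary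
representation of `Q` on `K` with almost invariant vectors. The Hilbert spaces of the
representations `π` range over the universe `w`. -/
def IsResolution {G : Type u} {Q : Type v} [Group G] [TopologicalSpace G]
    [Group Q] [TopologicalSpace Q] (p : G →* Q) : Prop :=
  Continuous p ∧ DenseRange p ∧
    ∀ (E : Type w) [NormedAddCommGroup E] [InnerProductSpace ℂ E] [CompleteSpace E]
      (π : UnitaryRep G E), π.HasAlmostInvariantVectors →
        ∃ K : Submodule ℂ E, IsClosed (K : Set E) ∧
          ∃ σ : UnitaryRep Q K, σ.HasAlmostInvariantVectors ∧
            ∀ (g : G) (ξ : K), ((σ.toHom (p g) ξ : K) : E) = π.toHom g (ξ : E)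

/-- The topology of a semidirect product: the product topology on the set `N × G`. -/
instance SemidirectProduct.instTopologicalSpaceProd {N G : Type*} [Group N] [Group G]
    [TopologicalSpace N] [TopologicalSpace G] {φ : G →* MulAut N} :
    TopologicalSpace (N ⋊[φ] G) :=
  TopologicalSpace.induced SemidirectProduct.equivProd inferInstance

/-! ### The subgroup `A` as a discrete group -/

/-- The group `G` regarded as a discrete group. -/
def DiscreteCopy (G : Type*) : Type _ := G

namespace DiscreteCopy

instance {G : Type*} [CommGroup G] : CommGroup (DiscreteCopy G) := inferInstanceAs (CommGroup G)

instance {G : Type*} : TopologicalSpace (DiscreteCopy G) := ⊥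

instance {G : Type*} : DiscreteTopology (DiscreteCopy G) := ⟨rfl⟩

end DiscreteCopy

variable {H : Type u} [CommGroup H] {Γ : Type v} [Group Γ]

/-- The inclusion into `H` of a subgroup `A` of `H`, where `A` is regarded as a discrete group. -/
def discreteIncl (A : Subgroup H) : DiscreteCopy A →* H := A.subtype

/-- The restriction to an invariant subgroup `A` of an action by automorphisms on `H`. -/
def restrictAction (φ : Γ →* MulAut H) (A : Subgroup H) (hA : ∀ γ, ∀ a ∈ A, φ γ a ∈ A) :
    Γ →* MulAut (DiscreteCopy A) where
  toFun γ :=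
    { toFun := fun a => (⟨φ γ (discreteIncl A a), hA γ _ (Subtype.property (p := (· ∈ A)) a)⟩ : A)
      invFun := fun a =>
        (⟨φ γ⁻¹ (discreteIncl A a), hA γ⁻¹ _ (Subtype.property (p := (· ∈ A)) a)⟩ : A)
      left_inv := fun a => Subtype.ext (p := (· ∈ A)) (by
        change φ γ⁻¹ (φ γ (discreteIncl A a)) = discreteIncl A a
        simp)
      right_inv := fun a => Subtype.ext (p := (· ∈ A)) (by
        change φ γ (φ γ⁻¹ (discreteIncl A a)) = discreteIncl A a
        simp)
      map_mul' := fun a b => Subtype.ext (p := (· ∈ A)) (map_mul (φ γ) _ _) }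
  map_one' := MulEquiv.ext fun a => Subtype.ext (p := (· ∈ A)) (by
    change φ 1 (discreteIncl A a) = discreteIncl A a
    simp)
  map_mul' γ δ := MulEquiv.ext fun a => Subtype.ext (p := (· ∈ A)) (by
    change φ (γ * δ) (discreteIncl A a) = φ γ (φ δ (discreteIncl A a))
    simp)

theorem discreteIncl_restrictAction (φ : Γ →* MulAut H) (A : Subgroup H)
    (hA : ∀ γ, ∀ a ∈ A, φ γ a ∈ A) (γ : Γ) (a : DiscreteCopy A) :
    discreteIncl A (restrictAction φ A hA γ a) = φ γ (discreteIncl A a) := rfl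

/-- The inclusion `A ⋊ Γ → H ⋊ Γ`, `(a, γ) ↦ (a, γ)`. -/
def semidirectIncl (φ : Γ →* MulAut H) (A : Subgroup H) (hA : ∀ γ, ∀ a ∈ A, φ γ a ∈ A) :
    DiscreteCopy A ⋊[restrictAction φ A hA] Γ →* H ⋊[φ] Γ :=
  SemidirectProduct.map (discreteIncl A) (MonoidHom.id Γ) fun _ => rfl

/-! ### Dual groups -/

/-- The restriction map `p : Ĥ → Â`, `η ↦ η|_A`. -/
def dualRestrict [TopologicalSpace H] (A : Subgroup H) :
    PontryaginDual H →ₜ* PontryaginDual (DiscreteCopy A) :=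
  PontryaginDual.map ⟨discreteIncl A, continuous_of_discreteTopology⟩

/-- The action on the dual group induced by an action by continuous automorphisms:
`(γ · η)(x) = η (γ⁻¹ x)`. -/
def dualAction {N : Type*} [CommGroup N] [TopologicalSpace N] (φ : Γ →* MulAut N)
    (hφ : ∀ γ, Continuous (φ γ)) (γ : Γ) : PontryaginDual N →ₜ* PontryaginDual N :=
  PontryaginDual.map ⟨(φ γ⁻¹).toMonoidHom, hφ γ⁻¹⟩

/-- The dual group carries its Borel σ-algebra. -/
instance PontryaginDual.instMeasurableSpaceBorel {N : Type*} [Monoid N] [TopologicalSpace N] :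
    MeasurableSpace (PontryaginDual N) := borel _

instance PontryaginDual.instBorelSpaceBorel {N : Type*} [Monoid N] [TopologicalSpace N] :
    BorelSpace (PontryaginDual N) := ⟨rfl⟩

/-! ### The norm distance of measures -/

/-- `‖μ - ν‖ = sup |∫ f dμ - ∫ f dν|` over the Borel functions `f : X → ℂ` with `‖f‖_∞ ≤ 1`
(for probability measures the set of these numbers is bounded by `2`). -/
def measureNormDist {X : Type*} [MeasurableSpace X] (μ ν : Measure X) : ℝ :=
  sSup {r : ℝ | ∃ f : X → ℂ, Measurable f ∧ (∀ x, ‖f x‖ ≤ 1) ∧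
    r = ‖(∫ x, f x ∂μ) - ∫ x, f x ∂ν‖}

end

/-! Suppose `μ n` gives `p(V)` mass at most `a < 1` for infinitely many `n`. As `p(V)` is
`Γ`-invariant and `Γ` is countable, it has an invariant Borel hull `B n` of the same `μ n`-measure
(`exists_invariant_hull`). The restrictions `m n` of `μ n` to the complements of these hulls are
still asymptotically invariant, still satisfy `∫ |χ(a) - 1|² → 0` for each `a ∈ A`, and have mass at
least `1 - a` infinitely often. They are all dominated by one finite quasi-invariant measure `ν`
with `ν(p(V)) = 0` (`exists_quasiInvariant_measure`).

Let `A` act on `L²(Â, ν)` by multiplication by characters and `Γ` by the Koopman representation. The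
normalized square roots of the densities `dm n/dν` provide almost invariant vectors
(`koopman_hasAlmostInvariantVectors`). The resolution property then gives a subrepresentation that
extends to `H ⋊ Γ` and has almost invariant vectors there. `measure_image_dualRestrict_ne_zero`
shows that this forces `ν(p(V)) ≠ 0`, a contradiction.

That last lemma avoids the spectral theorem for `H`. Smear an almost invariant vector `ξ` with a
bump function `f` on `H` to get `ζ`. Then `|χ(a) - 1| |ζ(χ)| ≤ ω(a) |ξ(χ)|` for almost every `χ`,
where `ω(a)` is the `L¹`-distance from `f` to its translate by `a`, a function continuous at `1`
with `ω(1) = 0`. Wherever `ζ(χ)` is comparable to `ξ(χ) ≠ 0`, the character `χ` is thus continuous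
for the topology of `H` and extends to `H`. If `χ` is moreover near `1` on a suitable finite subset
of `A`, the extension lies in `V`. The remaining `χ` carry too little of `‖ξ‖²`. -/

noncomputable section

/-! ### Extension of characters from a dense subgroup -/

/-- A character of a dense subgroup which is continuous at `1` for the induced topology extends to
the whole group. -/
theorem exists_pontryaginDual_extend {H : Type*} [CommGroup H] [TopologicalSpace H]
    [IsTopologicalGroup H] (A : Subgroup H) (hA : Dense (A : Set H)) (χ : A →* Circle)
    (hχ : ContinuousAt χ 1) : ∃ η : PontryaginDual H, ∀ a : A, η a = χ a := by
  -- A homomorphism continuous at `1` is uniformly continuous, so it extends to `H` because `Circle`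
  -- is complete.
  let _ : UniformSpace H := IsTopologicalGroup.rightUniformSpace H
  have : IsUniformGroup H := isUniformGroup_of_commGroup
  have hu : UniformContinuous χ := uniformContinuous_of_continuousAt_one χ hχ
  have hd : Dense (A : Set H) := hA
  have hc : Continuous (hd.extend χ) := (hd.uniformContinuous_extend hu).continuous
  have he : ∀ a : A, hd.extend χ a = χ a := fun a => hd.extend_eq hu.continuous a
  have hr : DenseRange ((↑) : A → H) := hd.denseRange_val
  have hmul : ∀ x y : H, hd.extend χ (x * y) = hd.extend χ x * hd.extend χ y := by
    intro x y
    refine hr.induction_on₂ (p := fun x y => hd.extend χ (x * y) = hd.extend χ x * hd.extend χ y)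
      ?_ ?_ x y
    · exact isClosed_eq (by fun_prop) (by fun_prop)
    · intro a b
      rw [he, he, ← map_mul, ← he, Subgroup.coe_mul]
  refine ⟨(⟨⟨⟨hd.extend χ, ?_⟩, hmul⟩, hc⟩ : H →ₜ* Circle), fun a => he a⟩
  have := he 1
  rwa [map_one] at this

theorem Circle.dist_eq_norm_sub_coe (z w : Circle) : dist z w = ‖(z : ℂ) - w‖ :=
  dist_eq_norm (z : ℂ) w

/-- Neighbourhoods of `1` in the dual contain the characters which are uniformly close to `1` on
some compact set. -/
theorem exists_compact_of_mem_nhds_one {H : Type*} [CommGroup H] [TopologicalSpace H]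
    {V : Set (PontryaginDual H)} (hV : V ∈ 𝓝 (1 : PontryaginDual H)) :
    ∃ F : Set H, IsCompact F ∧ ∃ δ : ℝ, 0 < δ ∧
      ∀ η : PontryaginDual H, (∀ h ∈ F, ‖(η h : ℂ) - 1‖ < δ) → η ∈ V := by
  have hi : IsInducing (ContinuousMonoidHom.toContinuousMap : (H →ₜ* Circle) → C(H, Circle)) :=
    ContinuousMonoidHom.isInducing_toContinuousMap H Circle
  have h1 : V ∈ comap (ContinuousMonoidHom.toContinuousMap : (H →ₜ* Circle) → C(H, Circle))
      (𝓝 (ContinuousMonoidHom.toContinuousMap (1 : H →ₜ* Circle))) := by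
    rw [← hi.nhds_eq_comap]; exact hV
  obtain ⟨W, hW, hWV⟩ := h1
  obtain ⟨S, hS, hSW⟩ := UniformSpace.mem_nhds_iff.1 hW
  obtain ⟨⟨F, T⟩, ⟨hF, hT⟩, hFT⟩ := ContinuousMap.hasBasis_compactConvergenceUniformity.mem_iff.1 hS
  obtain ⟨δ, hδ, hδT⟩ := Metric.mem_uniformity_dist.1 hT
  refine ⟨F, hF, δ, hδ, fun η hη => hWV (hSW (hFT ?_))⟩
  intro x hx
  refine hδT ?_
  have h2 : dist (η x) 1 < δ := by
    rw [Circle.dist_eq_norm_sub_coe]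
    exact hη x hx
  rw [dist_comm] at h2
  exact h2

/-- If a character is close to `1` on the points of a dense subgroup lying in an open set, then it
is close to `1` on that open set. -/
theorem norm_char_sub_one_le_of_dense {H : Type*} [CommGroup H] [TopologicalSpace H]
    {A : Subgroup H} (hA : Dense (A : Set H)) (η : PontryaginDual H) {U : Set H} (hU : IsOpen U)
    {c : ℝ} (h : ∀ a ∈ A, a ∈ U → ‖(η a : ℂ) - 1‖ ≤ c) : ∀ x ∈ U, ‖(η x : ℂ) - 1‖ ≤ c := by
  intro x hx
  have hcl : IsClosed {x : H | ‖(η x : ℂ) - 1‖ ≤ c} :=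
    isClosed_le ((continuous_subtype_val.comp (map_continuous η)).sub continuous_const).norm
      continuous_const
  have := hA.open_subset_closure_inter hU hx
  exact closure_minimal (fun y hy => h y hy.2 hy.1) hcl this

/-- A compact set is covered by finitely many translates, by elements of a dense subgroup, of a
neighbourhood of `1`. -/
theorem IsCompact.exists_finset_dense_translates {H : Type*} [CommGroup H] [TopologicalSpace H]
    [IsTopologicalGroup H] {A : Subgroup H} (hA : Dense (A : Set H)) {F U : Set H}
    (hF : IsCompact F) (hU : IsOpen U) (h1 : (1 : H) ∈ U) :
    ∃ t : Finset A, ∀ h ∈ F, ∃ a ∈ t, (a : H)⁻¹ * h ∈ U := by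
  obtain ⟨t, ht⟩ := hF.elim_finite_subcover (fun a : A => {h : H | (a : H)⁻¹ * h ∈ U})
    (fun a => hU.preimage (continuous_const_mul _)) (by
      intro h _
      -- This open set contains `h`, hence meets `A`.
      have hO : IsOpen {y : H | y⁻¹ * h ∈ U} := hU.preimage (by fun_prop)
      obtain ⟨y, hy, hyA⟩ := hA.inter_open_nonempty _ hO ⟨h, by simpa using h1⟩
      exact Set.mem_iUnion.2 ⟨⟨y, hyA⟩, hy⟩)
  refine ⟨t, fun h hh => ?_⟩
  obtain ⟨a, ha⟩ := Set.mem_iUnion.1 (ht hh)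
  obtain ⟨hat, hah⟩ := Set.mem_iUnion.1 ha
  exact ⟨a, hat, hah⟩

/-- A character of the discrete copy of a dense subgroup, which is dominated near `1` and close to
`1` on suitable translates, is the restriction of a character close to `1` on a given set. -/
theorem exists_dualRestrict_eq {H : Type*} [CommGroup H] [TopologicalSpace H]
    [IsTopologicalGroup H] {A : Subgroup H} (hA : Dense (A : Set H))
    (χ : PontryaginDual (DiscreteCopy A)) {ω : H → ℝ} (hω : ContinuousAt ω 1) (hω1 : ω 1 = 0)
    (hχω : ∀ a : DiscreteCopy A, ‖(χ a : ℂ) - 1‖ ≤ ω (discreteIncl A a))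
    {F U : Set H} (hU : IsOpen U) {c : ℝ} (hc : ∀ x ∈ U, ω x ≤ c) {d : ℝ}
    (t : Finset A) (ht : ∀ h ∈ F, ∃ a ∈ t, (a : H)⁻¹ * h ∈ U)
    (hχt : ∀ a ∈ t, ‖(χ (a : A) : ℂ) - 1‖ ≤ d) :
    ∃ η : PontryaginDual H, dualRestrict A η = χ ∧ ∀ h ∈ F, ‖(η h : ℂ) - 1‖ ≤ d + c := by
  -- The same homomorphism, but `A` now has the subspace topology of `H`, for which continuity is a
  -- genuine condition.
  let χ' : A →* Circle := (χ : DiscreteCopy A →* Circle)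
  have hcont : ContinuousAt χ' 1 := by
    have h0 : Tendsto (fun a : A => ω a) (𝓝 1) (𝓝 0) := by
      have h2 : Tendsto ω (𝓝 ((1 : A) : H)) (𝓝 0) := by
        have := hω.tendsto
        rwa [hω1] at this
      exact h2.comp continuous_subtype_val.continuousAt
    rw [ContinuousAt, tendsto_iff_dist_tendsto_zero]
    refine squeeze_zero (fun _ => dist_nonneg) (fun a => ?_) h0
    rw [map_one, Circle.dist_eq_norm_sub_coe]
    exact hχω a
  obtain ⟨η, hη⟩ := exists_pontryaginDual_extend A hA χ' hcont
  refine ⟨η, PontryaginDual.ext fun a => hη a, fun h hh => ?_⟩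
  obtain ⟨a, hat, hah⟩ := ht h hh
  have h1 : ‖(η ((a : H)⁻¹ * h) : ℂ) - 1‖ ≤ c :=
    norm_char_sub_one_le_of_dense hA η hU (fun b hb hbU => by
      have := hη ⟨b, hb⟩
      simp only at this
      rw [this]
      exact (hχω (⟨b, hb⟩ : A)).trans (hc b hbU)) _ hah
  have h2 : ‖(η a : ℂ) - 1‖ ≤ d := by
    rw [hη a]; exact hχt a hat
  have h3 : (η h : ℂ) = η a * η ((a : H)⁻¹ * h) := by
    rw [← Circle.coe_mul, ← map_mul, mul_inv_cancel_left]
  have h4 : (η h : ℂ) - 1 = η a * ((η ((a : H)⁻¹ * h) : ℂ) - 1) + ((η a : ℂ) - 1) := by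
    rw [h3]; ring
  rw [h4]
  refine (norm_add_le _ _).trans ?_
  rw [norm_mul, Circle.norm_coe, one_mul]
  linarith

/-! ### Norms in `L²` and pointwise domination -/

theorem Lp_two_norm_sq {X : Type*} [MeasurableSpace X] {ν : Measure X} (f : Lp ℂ 2 ν) :
    ‖f‖ ^ 2 = ∫ x, ‖f x‖ ^ 2 ∂ν := by
  have h1 : inner ℂ f f = ((‖f‖ ^ 2 : ℝ) : ℂ) := by
    rw [inner_self_eq_norm_sq_to_K]; norm_cast
  have h2 : inner ℂ f f = ((∫ x, ‖f x‖ ^ 2 ∂ν : ℝ) : ℂ) := by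
    rw [L2.inner_def, ← integral_complex_ofReal]
    refine integral_congr_ae (Eventually.of_forall fun x => ?_)
    simp only [inner_self_eq_norm_sq_to_K]
    norm_cast
  exact_mod_cast h1.symm.trans h2

theorem Lp_two_integrable_sq {X : Type*} [MeasurableSpace X] {ν : Measure X} (f : Lp ℂ 2 ν) :
    Integrable (fun x => ‖f x‖ ^ 2) ν :=
  (Lp.memLp f).integrable_norm_pow (by norm_num)

/-- An inequality between the `L²`-norms on all measurable sets gives a pointwise inequality. -/
theorem Lp_two_ae_norm_le {X : Type*} [MeasurableSpace X] {ν : Measure X} (u v : Lp ℂ 2 ν) {c : ℝ}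
    (hc : 0 ≤ c) (h : ∀ B, MeasurableSet B →
      ‖LpToLpRestrictCLM X ℂ ℂ ν 2 B u‖ ≤ c * ‖LpToLpRestrictCLM X ℂ ℂ ν 2 B v‖) :
    ∀ᵐ x ∂ν, ‖u x‖ ≤ c * ‖v x‖ := by
  have key : ∀ (B : Set X) (f : Lp ℂ 2 ν),
      ‖LpToLpRestrictCLM X ℂ ℂ ν 2 B f‖ ^ 2 = ∫ x in B, ‖f x‖ ^ 2 ∂ν := fun B f => by
    rw [Lp_two_norm_sq]
    refine integral_congr_ae ?_
    filter_upwards [LpToLpRestrictCLM_coeFn (F := ℂ) ℂ B f] with x hx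
    rw [hx]
  have h1 : (fun x => ‖u x‖ ^ 2) ≤ᵐ[ν] fun x => c ^ 2 * ‖v x‖ ^ 2 := by
    refine ae_le_of_forall_setIntegral_le (Lp_two_integrable_sq u)
      ((Lp_two_integrable_sq v).const_mul _) fun B hB _ => ?_
    rw [integral_const_mul, ← key, ← key, ← mul_pow]
    exact pow_le_pow_left₀ (norm_nonneg _) (h B hB) 2
  filter_upwards [h1] with x hx
  rw [← mul_pow] at hx
  exact le_of_sq_le_sq hx (by positivity)

/-! ### Smearing vectors by densities on `H` -/

section Convolution

open scoped Pointwise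

variable {H : Type*} [CommGroup H] [TopologicalSpace H] [MeasurableSpace H] [BorelSpace H]

theorem exists_normalized_bump [IsTopologicalGroup H] [LocallyCompactSpace H] (m : Measure H) [m.IsHaarMeasure] :
    ∃ f : H → ℝ, Continuous f ∧ HasCompactSupport f ∧ (∀ h, 0 ≤ f h) ∧ ∫ h, f h ∂m = 1 := by
  obtain ⟨g, hg, hg0, hg1⟩ := exists_continuous_nonneg_pos (1 : H)
  have hpos : 0 < ∫ h, g h ∂m :=
    g.continuous.integral_pos_of_hasCompactSupport_nonneg_nonzero hg hg0 hg1
  refine ⟨fun h => (∫ h, g h ∂m)⁻¹ * g h, by fun_prop, hg.mul_left, fun h => ?_, ?_⟩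
  · exact mul_nonneg (inv_nonneg.2 hpos.le) (hg0 h)
  · rw [integral_const_mul, inv_mul_cancel₀ hpos.ne']

/-- Translation is continuous in `L¹` on a compactly supported continuous function. -/
theorem continuousAt_integral_translate_sub [IsTopologicalGroup H] [LocallyCompactSpace H]
    (m : Measure H) [m.IsHaarMeasure] {f : H → ℝ}
    (hf : Continuous f) (hfc : HasCompactSupport f) :
    ContinuousAt (fun a : H => ∫ h, |f (a⁻¹ * h) - f h| ∂m) 1 := by
  obtain ⟨W, hW, hW1⟩ := exists_compact_mem_nhds (1 : H)
  -- For all `a ∈ W` the integrand is supported in this one compact set.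
  have hk : IsCompact (W * tsupport f ∪ tsupport f) := (hW.mul hfc).union hfc
  refine ContinuousOn.continuousAt (s := W) ?_ hW1
  refine continuousOn_integral_of_compact_support hk (f := fun a h => |f (a⁻¹ * h) - f h|) ?_ ?_
  · exact Continuous.continuousOn (by unfold Function.uncurry; fun_prop)
  · intro a h ha hh
    have h1 : f h = 0 := image_eq_zero_of_notMem_tsupport fun h' => hh (Or.inr h')
    have h2 : f (a⁻¹ * h) = 0 := image_eq_zero_of_notMem_tsupport fun h' =>
      hh (Or.inl ⟨a, ha, _, h', mul_inv_cancel_left a h⟩)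
    simp [h1, h2]

variable {K : Type*} [NormedAddCommGroup K] [InnerProductSpace ℂ K]

theorem integrable_smul_orbit (m : Measure H) [m.IsHaarMeasure] (σ : UnitaryRep H K) (ξ : K)
    {f : H → ℝ} (hf : Continuous f) (hfc : HasCompactSupport f) :
    Integrable (fun h => (f h : ℂ) • σ.toHom h ξ) m := by
  have h1 : Continuous fun h => (f h : ℂ) • σ.toHom h ξ :=
    (Complex.continuous_ofReal.comp hf).smul (σ.continuous_orbit ξ)
  refine h1.integrable_of_hasCompactSupport ?_
  refine hfc.mono fun h hh => ?_
  contrapose! hh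
  simp only [Function.mem_support, ne_eq, not_not] at hh ⊢
  simp [hh]

/-- Smearing a vector by a probability density moves it no more than the elements of the support
do. -/
theorem norm_integral_smul_orbit_sub_le [CompleteSpace K] (m : Measure H) [m.IsHaarMeasure]
    (σ : UnitaryRep H K) (ξ : K) {f : H → ℝ} (hf : Continuous f) (hfc : HasCompactSupport f)
    (hf0 : ∀ h, 0 ≤ f h) (hf1 : ∫ h, f h ∂m = 1) {ε : ℝ}
    (hξ : ∀ h ∈ tsupport f, ‖σ.toHom h ξ - ξ‖ ≤ ε) :
    ‖(∫ h, (f h : ℂ) • σ.toHom h ξ ∂m) - ξ‖ ≤ ε := by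
  have hfi : Integrable f m := hf.integrable_of_hasCompactSupport hfc
  have h1 : ξ = ∫ h, (f h : ℂ) • ξ ∂m := by
    rw [integral_smul_const, integral_complex_ofReal, hf1, Complex.ofReal_one, one_smul]
  have h2 : (∫ h, (f h : ℂ) • σ.toHom h ξ ∂m) - ξ =
      ∫ h, (f h : ℂ) • (σ.toHom h ξ - ξ) ∂m := by
    have hi : Integrable (fun h => (f h : ℂ) • ξ) m := (hfi.ofReal (𝕜 := ℂ)).smul_const ξ
    simp_rw [smul_sub]
    rw [integral_sub (integrable_smul_orbit m σ ξ hf hfc) hi, ← h1]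
  rw [h2]
  calc ‖∫ h, (f h : ℂ) • (σ.toHom h ξ - ξ) ∂m‖ ≤ ∫ h, f h * ε ∂m := by
        refine norm_integral_le_of_norm_le (hfi.mul_const ε) (Eventually.of_forall fun h => ?_)
        rw [norm_smul, Complex.norm_real, Real.norm_of_nonneg (hf0 h)]
        by_cases hh : h ∈ tsupport f
        · exact mul_le_mul_of_nonneg_left (hξ h hh) (hf0 h)
        · simp [image_eq_zero_of_notMem_tsupport hh]
    _ = ε := by rw [integral_mul_const, hf1, one_mul]

/-- By left invariance of Haar measure, translating the smeared vector amounts to translating the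
density. The displacement is thereby governed by `f` alone, not by how far the group moves `ξ`. -/
theorem map_integral_smul_orbit_sub [IsTopologicalGroup H] [CompleteSpace K]
    (m : Measure H) [m.IsHaarMeasure]
    (σ : UnitaryRep H K) (ξ : K) {f : H → ℝ} (hf : Continuous f) (hfc : HasCompactSupport f)
    (a : H) :
    σ.toHom a (∫ h, (f h : ℂ) • σ.toHom h ξ ∂m) - ∫ h, (f h : ℂ) • σ.toHom h ξ ∂m =
      ∫ h, ((f (a⁻¹ * h) - f h : ℝ) : ℂ) • σ.toHom h ξ ∂m := by
  have hf' : Continuous fun h => f (a⁻¹ * h) := by fun_prop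
  have hfc' : HasCompactSupport fun h => f (a⁻¹ * h) :=
    hfc.comp_homeomorph (Homeomorph.mulLeft a⁻¹)
  have h1 : σ.toHom a (∫ h, (f h : ℂ) • σ.toHom h ξ ∂m) =
      ∫ h, (f (a⁻¹ * h) : ℂ) • σ.toHom h ξ ∂m := by
    have := (σ.toHom a).toContinuousLinearEquiv.toContinuousLinearMap.integral_comp_comm
      (integrable_smul_orbit m σ ξ hf hfc)
    refine Eq.trans this.symm ?_
    rw [← integral_mul_left_eq_self (fun h => (f (a⁻¹ * h) : ℂ) • σ.toHom h ξ) a]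
    refine integral_congr_ae (Eventually.of_forall fun h => ?_)
    simp only [inv_mul_cancel_left, map_mul, map_smul]
    rfl
  rw [h1, ← integral_sub (integrable_smul_orbit m σ ξ hf' hfc')
    (integrable_smul_orbit m σ ξ hf hfc)]
  simp only [Complex.ofReal_sub, sub_smul]

/-- A seminorm `‖T ·‖` which is constant on the orbit of `ξ` controls the displacement of a smeared
vector. -/
theorem norm_map_integral_smul_orbit_sub_le [IsTopologicalGroup H] [CompleteSpace K]
    (m : Measure H) [m.IsHaarMeasure]
    (σ : UnitaryRep H K) (ξ : K) {f : H → ℝ} (hf : Continuous f) (hfc : HasCompactSupport f)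
    {E : Type*} [NormedAddCommGroup E] [NormedSpace ℂ E] [CompleteSpace E] (T : K →L[ℂ] E)
    (hT : ∀ h, ‖T (σ.toHom h ξ)‖ = ‖T ξ‖) (a : H) :
    ‖T (σ.toHom a (∫ h, (f h : ℂ) • σ.toHom h ξ ∂m) - ∫ h, (f h : ℂ) • σ.toHom h ξ ∂m)‖ ≤
      (∫ h, |f (a⁻¹ * h) - f h| ∂m) * ‖T ξ‖ := by
  have hf' : Continuous fun h => f (a⁻¹ * h) - f h := by fun_prop
  have hfc' : HasCompactSupport fun h => f (a⁻¹ * h) - f h :=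
    (hfc.comp_homeomorph (Homeomorph.mulLeft a⁻¹)).sub hfc
  rw [map_integral_smul_orbit_sub m σ ξ hf hfc a,
    ← T.integral_comp_comm (integrable_smul_orbit m σ ξ hf' hfc'), ← integral_mul_const]
  refine norm_integral_le_of_norm_le
    ((hf'.integrable_of_hasCompactSupport hfc').abs.mul_const _)
    (Eventually.of_forall fun h => ?_)
  rw [map_smul, norm_smul, hT, Complex.norm_real, Real.norm_eq_abs]

end Convolution

/-! ### Almost invariant vectors charge the restrictions of characters near `1` -/

/-- Let a unitary representation of `H` with almost invariant vectors be modelled, over a dense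
countable subgroup `A`, by multiplication by characters on a subspace of `L²(Â, ν)`. Then `ν` does
not vanish on the restrictions of the characters in a neighbourhood of `1`. -/
theorem measure_image_dualRestrict_ne_zero {H : Type*} [CommGroup H] [TopologicalSpace H]
    [IsTopologicalGroup H] [LocallyCompactSpace H] [T2Space H] (A : Subgroup H)
    (hAcount : Countable A) (hAdense : Dense (A : Set H))
    (ν : Measure (PontryaginDual (DiscreteCopy A)))
    {K : Type*} [NormedAddCommGroup K] [InnerProductSpace ℂ K] [CompleteSpace K]
    (J : K →ₗᵢ[ℂ] Lp ℂ 2 ν) (σ : UnitaryRep H K) (hσ : σ.HasAlmostInvariantVectors)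
    (hJ : ∀ (a : DiscreteCopy A) (ξ : K),
      J (σ.toHom (discreteIncl A a) ξ) =ᵐ[ν] fun χ => (χ a : ℂ) * J ξ χ)
    {V : Set (PontryaginDual H)} (hV : V ∈ 𝓝 (1 : PontryaginDual H)) :
    ν (dualRestrict A '' V) ≠ 0 := by
  intro h0
  obtain ⟨F, hF, δ, hδ, hFV⟩ := exists_compact_of_mem_nhds_one hV
  borelize H
  let m : Measure H := Measure.haar
  obtain ⟨f, hf, hfc, hf0, hf1⟩ := exists_normalized_bump m
  let ω : H → ℝ := fun a => ∫ h, |f (a⁻¹ * h) - f h| ∂m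
  have hω : ContinuousAt ω 1 := continuousAt_integral_translate_sub m hf hfc
  have hω1 : ω 1 = 0 := by simp [ω]
  have hω0 : ∀ a, 0 ≤ ω a := fun a => integral_nonneg fun h => abs_nonneg _
  -- The characters found below satisfy `|χ - 1| ≤ 2ω ≤ δ/4` on `A ∩ U` and `|χ - 1| ≤ δ/2` on `t`,
  -- so their extensions stay within `3δ/4 < δ` of `1` on `F`.
  obtain ⟨U, hUω, hU, hU1⟩ : ∃ U : Set H, (∀ x ∈ U, ω x < δ / 8) ∧ IsOpen U ∧ (1 : H) ∈ U := by
    have : {x | ω x < δ / 8} ∈ 𝓝 (1 : H) :=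
      hω.eventually_lt continuousAt_const (by rw [hω1]; positivity)
    obtain ⟨U, hU, hUo, h1⟩ := mem_nhds_iff.1 this
    exact ⟨U, fun x hx => hU hx, hUo, h1⟩
  obtain ⟨t, ht⟩ := IsCompact.exists_finset_dense_translates hAdense hF hU hU1
  -- Chosen so that the final error `(4 + 4 |t| / δ²) (1/M)²` equals `1/M ≤ 1/4`, contradicting `‖ξ‖
  -- = 1`.
  let M : ℝ := 4 + 4 * t.card / δ ^ 2
  have hM : 4 ≤ M := le_add_of_nonneg_right (by positivity)
  have hε : 0 < 1 / M := by positivity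
  obtain ⟨ξ, hξ1, hξ⟩ := hσ (1 / M) hε (tsupport f ∪ (fun a : A => (a : H)) '' t)
    (hfc.isCompact.union (t.finite_toSet.image _).isCompact)
  let ζ : K := ∫ h, (f h : ℂ) • σ.toHom h ξ ∂m
  have hζ : ‖ζ - ξ‖ ≤ 1 / M :=
    norm_integral_smul_orbit_sub_le m σ ξ hf hfc hf0 hf1 fun h hh => hξ h (Or.inl hh)
  have hdisp : ∀ a : DiscreteCopy A, ∀ᵐ χ ∂ν,
      ‖((χ a : ℂ) - 1) * J ζ χ‖ ≤ ω (discreteIncl A a) * ‖J ξ χ‖ := by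
    intro a
    have h1 : ∀ᵐ χ ∂ν, ‖J (σ.toHom (discreteIncl A a) ζ - ζ) χ‖ ≤
        ω (discreteIncl A a) * ‖J ξ χ‖ := by
      -- The pointwise bound is tested on each measurable `B`. The norm of the restriction to `B` is
      -- constant on the `A`-orbit of `ξ`, since characters have modulus one, and hence on the
      -- `H`-orbit by density and strong continuity.
      refine Lp_two_ae_norm_le _ _ (hω0 _) fun B hB => ?_
      let T := (LpToLpRestrictCLM _ ℂ ℂ ν 2 B).comp J.toContinuousLinearMap
      refine norm_map_integral_smul_orbit_sub_le m σ ξ hf hfc T (fun h => ?_) _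
      refine hAdense.denseRange_val.induction_on (p := fun h => ‖T (σ.toHom h ξ)‖ = ‖T ξ‖) h ?_ ?_
      · exact isClosed_eq (T.continuous.comp (σ.continuous_orbit ξ)).norm continuous_const
      · intro b
        have h2 : ‖T (σ.toHom b ξ)‖ ^ 2 = ‖T ξ‖ ^ 2 := by
          rw [Lp_two_norm_sq, Lp_two_norm_sq]
          refine integral_congr_ae ?_
          filter_upwards [LpToLpRestrictCLM_coeFn (F := ℂ) ℂ B (J (σ.toHom b ξ)),
            LpToLpRestrictCLM_coeFn (F := ℂ) ℂ B (J ξ), ae_restrict_of_ae (hJ b ξ)] with χ e1 e2 e3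
          have e4 : T (σ.toHom b ξ) χ = J (σ.toHom b ξ) χ := e1
          have e5 : T ξ χ = J ξ χ := e2
          have e6 : J (σ.toHom b ξ) χ = (χ b : ℂ) * J ξ χ := e3
          rw [e4, e5, e6, norm_mul, Circle.norm_coe, one_mul]
        exact (pow_left_inj₀ (norm_nonneg _) (norm_nonneg _) two_ne_zero).1 h2
    rw [map_sub] at h1
    filter_upwards [h1, hJ a ζ, Lp.coeFn_sub (J (σ.toHom (discreteIncl A a) ζ)) (J ζ)]
      with χ e1 e2 e3
    rw [e3, Pi.sub_apply, e2] at e1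
    rwa [sub_mul, one_mul]
  -- Countability of `A` lets the almost everywhere statements hold for all `a` simultaneously.
  have : Countable (DiscreteCopy A) := hAcount
  -- Outside the null set `p(V)` one of two defects occurs: `ζ` is far from `ξ` at `χ`, or `χ` is
  -- far from `1` at some point of `t`. Each term on the right pays for one of them.
  have hbad : ∀ᵐ χ ∂ν, ‖J ξ χ‖ ^ 2 ≤ 4 * ‖J (ζ - ξ) χ‖ ^ 2 +
      4 / δ ^ 2 * ∑ a ∈ t, ‖J (σ.toHom a ξ - ξ) χ‖ ^ 2 := by
    have hJt : ∀ᵐ χ ∂ν, ∀ a : DiscreteCopy A, J (σ.toHom (discreteIncl A a) ξ - ξ) χ =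
        ((χ a : ℂ) - 1) * J ξ χ := by
      refine ae_all_iff.2 fun a => ?_
      rw [map_sub]
      filter_upwards [hJ a ξ, Lp.coeFn_sub (J (σ.toHom (discreteIncl A a) ξ)) (J ξ)] with χ e1 e2
      rw [e2, Pi.sub_apply, e1, sub_mul, one_mul]
    have hsub := Lp.coeFn_sub (J ζ) (J ξ)
    rw [← map_sub] at hsub
    filter_upwards [ae_all_iff.2 hdisp, hJt, hsub, measure_eq_zero_iff_ae_notMem.1 h0]
      with χ e1 e2 e3 e4
    have hsum0 : 0 ≤ ∑ a ∈ t, ‖J (σ.toHom a ξ - ξ) χ‖ ^ 2 :=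
      Finset.sum_nonneg fun _ _ => by positivity
    by_cases c1 : ‖J ξ χ‖ ≤ 2 * ‖J (ζ - ξ) χ‖
    · have : ‖J ξ χ‖ ^ 2 ≤ (2 * ‖J (ζ - ξ) χ‖) ^ 2 := pow_le_pow_left₀ (norm_nonneg _) c1 2
      have : 0 ≤ 4 / δ ^ 2 * ∑ a ∈ t, ‖J (σ.toHom a ξ - ξ) χ‖ ^ 2 := by positivity
      linarith [mul_pow 2 (‖J (ζ - ξ) χ‖) 2]
    by_cases c2 : ∃ a ∈ t, δ / 2 < ‖(χ (a : A) : ℂ) - 1‖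
    · obtain ⟨a, hat, ha⟩ := c2
      have h1 : ‖J (σ.toHom a ξ - ξ) χ‖ ^ 2 ≤ ∑ a ∈ t, ‖J (σ.toHom a ξ - ξ) χ‖ ^ 2 :=
        Finset.single_le_sum (f := fun a : A => ‖J (σ.toHom a ξ - ξ) χ‖ ^ 2)
          (fun _ _ => by positivity) hat
      have h2 : δ / 2 * ‖J ξ χ‖ ≤ ‖J (σ.toHom a ξ - ξ) χ‖ := by
        have := e2 a
        have e5 : J (σ.toHom a ξ - ξ) χ = ((χ (a : A) : ℂ) - 1) * J ξ χ := this
        rw [e5, norm_mul]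
        exact mul_le_mul_of_nonneg_right ha.le (norm_nonneg _)
      have h3 : (δ / 2 * ‖J ξ χ‖) ^ 2 ≤ ∑ a ∈ t, ‖J (σ.toHom a ξ - ξ) χ‖ ^ 2 :=
        (pow_le_pow_left₀ (by positivity) h2 2).trans h1
      have h4 : ‖J ξ χ‖ ^ 2 = 4 / δ ^ 2 * (δ / 2 * ‖J ξ χ‖) ^ 2 := by field_simp; norm_num
      have h5 : ‖J ξ χ‖ ^ 2 ≤ 4 / δ ^ 2 * ∑ a ∈ t, ‖J (σ.toHom a ξ - ξ) χ‖ ^ 2 := by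
        rw [h4]; exact mul_le_mul_of_nonneg_left h3 (by positivity)
      have : 0 ≤ 4 * ‖J (ζ - ξ) χ‖ ^ 2 := by positivity
      linarith
    -- Without either defect `χ` extends to a character in `V`, which the nullity of `p(V)`
    -- excludes.
    exfalso
    push Not at c1 c2
    have hξpos : 0 < ‖J ξ χ‖ := lt_of_le_of_lt (by positivity) c1
    have hζξ : ‖J ξ χ‖ ≤ 2 * ‖J ζ χ‖ := by
      have h1 : J ξ χ = J ζ χ - J (ζ - ξ) χ := by rw [e3, Pi.sub_apply]; ring
      have h2 : ‖J ξ χ‖ ≤ ‖J ζ χ‖ + ‖J (ζ - ξ) χ‖ := by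
        conv_lhs => rw [h1]
        exact norm_sub_le _ _
      linarith
    have hχω : ∀ a : DiscreteCopy A, ‖(χ a : ℂ) - 1‖ ≤ 2 * ω (discreteIncl A a) := fun a => by
      have h1 := e1 a
      rw [norm_mul] at h1
      have h2 : ‖(χ a : ℂ) - 1‖ * ‖J ξ χ‖ ≤ 2 * ω (discreteIncl A a) * ‖J ξ χ‖ := by
        have := mul_le_mul_of_nonneg_left hζξ (norm_nonneg ((χ a : ℂ) - 1))
        linarith
      exact le_of_mul_le_mul_right h2 hξpos
    obtain ⟨η, hη, hηF⟩ := exists_dualRestrict_eq hAdense χ (ω := fun a => 2 * ω a)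
      (F := F) (U := U) (c := δ / 4) (d := δ / 2) (hω.const_mul 2)
      (by simp [hω1]) (fun a => hχω a) hU (fun x hx => by linarith [hUω x hx]) t ht c2
    exact e4 ⟨η, hFV η fun h hh => (hηF h hh).trans_lt (by linarith), hη⟩
  have hint : ‖J ξ‖ ^ 2 ≤ 4 * ‖J (ζ - ξ)‖ ^ 2 +
      4 / δ ^ 2 * ∑ a ∈ t, ‖J (σ.toHom a ξ - ξ)‖ ^ 2 := by
    simp only [Lp_two_norm_sq]
    rw [← integral_finsetSum _ fun a _ => Lp_two_integrable_sq _, ← integral_const_mul,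
      ← integral_const_mul, ← integral_add ((Lp_two_integrable_sq _).const_mul _)
        ((integrable_finsetSum _ fun a _ => Lp_two_integrable_sq _).const_mul _)]
    exact integral_mono_ae (Lp_two_integrable_sq _)
      (((Lp_two_integrable_sq _).const_mul _).add
        ((integrable_finsetSum _ fun a _ => Lp_two_integrable_sq _).const_mul _)) hbad
  simp only [J.norm_map, hξ1] at hint
  have hs : ∑ a ∈ t, ‖σ.toHom (a : H) ξ - ξ‖ ^ 2 ≤ t.card * (1 / M) ^ 2 := by
    rw [← nsmul_eq_mul]
    exact Finset.sum_le_card_nsmul _ _ _ fun a ha =>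
      pow_le_pow_left₀ (norm_nonneg _) (hξ a (Or.inr ⟨a, ha, rfl⟩)) 2
  have h1 : ‖ζ - ξ‖ ^ 2 ≤ (1 / M) ^ 2 := pow_le_pow_left₀ (norm_nonneg _) hζ 2
  have h2 : 4 / δ ^ 2 * ∑ a ∈ t, ‖σ.toHom (a : H) ξ - ξ‖ ^ 2 ≤
      4 / δ ^ 2 * (t.card * (1 / M) ^ 2) := mul_le_mul_of_nonneg_left hs (by positivity)
  have h3 : 4 * (1 / M) ^ 2 + 4 / δ ^ 2 * (t.card * (1 / M) ^ 2) = 1 / M := by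
    have : 4 * (1 / M) ^ 2 + 4 / δ ^ 2 * (t.card * (1 / M) ^ 2) = M * (1 / M) ^ 2 := by
      simp only [M]; ring
    rw [this]; field_simp
  have h4 : 1 / M ≤ 1 / 4 := one_div_le_one_div_of_le (by norm_num) hM
  linarith

/-! ### Small models of separable Hilbert spaces -/

/-- Orthonormal vectors are at distance at least `1`, so the balls of radius `1/2` around them are
disjoint open sets in a separable space. -/
theorem Orthonormal.countable_index {F : Type*} [NormedAddCommGroup F] [InnerProductSpace ℂ F]
    [TopologicalSpace.SeparableSpace F] {ι : Type*} {v : ι → F} (hv : Orthonormal ℂ v) :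
    Countable ι := by
  have hd : ∀ i j, i ≠ j → 1 ≤ dist (v i) (v j) := by
    intro i j hij
    have h1 := norm_sub_sq (𝕜 := ℂ) (v i) (v j)
    rw [hv.1, hv.1, hv.2 hij, map_zero] at h1
    rw [dist_eq_norm]
    nlinarith [norm_nonneg (v i - v j)]
  have hp : (Set.univ : Set ι).PairwiseDisjoint fun i => Metric.ball (v i) (1 / 2) := by
    intro i _ j _ hij
    refine Metric.ball_disjoint_ball ?_
    have := hd i j hij
    linarith
  exact Set.countable_univ_iff.1 (hp.countable_of_isOpen (fun _ _ => Metric.isOpen_ball)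
    fun i _ => ⟨v i, Metric.mem_ball_self (by norm_num)⟩)

/-- A separable Hilbert space is isometric to one in any given universe. -/
theorem exists_linearIsometryEquiv_universe (F : Type v) [NormedAddCommGroup F]
    [InnerProductSpace ℂ F] [CompleteSpace F] [TopologicalSpace.SeparableSpace F] :
    ∃ (E : Type w) (_ : NormedAddCommGroup E) (_ : InnerProductSpace ℂ E) (_ : CompleteSpace E),
      Nonempty (F ≃ₗᵢ[ℂ] E) := by
  obtain ⟨s, b, -⟩ := exists_hilbertBasis ℂ F
  have : Countable s := b.orthonormal.countable_index
  obtain ⟨f, hf⟩ := exists_injective_nat s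
  let e : s ≃ ULift.{w} (Set.range f) := (Equiv.ofInjective f hf).trans Equiv.ulift.symm
  have hon : Orthonormal ℂ (b ∘ e.symm) := b.orthonormal.comp _ e.symm.injective
  let b' : HilbertBasis (ULift.{w} (Set.range f)) ℂ F := HilbertBasis.mk hon (by
    rw [e.symm.surjective.range_comp]
    exact b.dense_span.ge)
  exact ⟨_, _, _, inferInstance, ⟨b'.repr⟩⟩

/-! ### Transport of representations -/

/-- Conjugation of a unitary representation by a unitary isomorphism. -/
def UnitaryRep.conj {G : Type*} [Group G] [TopologicalSpace G]
    {E F : Type*} [NormedAddCommGroup E] [InnerProductSpace ℂ E] [NormedAddCommGroup F]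
    [InnerProductSpace ℂ F] (π : UnitaryRep G F) (e : F ≃ₗᵢ[ℂ] E) : UnitaryRep G E where
  toHom :=
    { toFun g := (e.symm.trans (π.toHom g)).trans e
      map_one' := by ext; simp
      map_mul' g h := by ext; simp }
  continuous_orbit ξ := e.continuous.comp (π.continuous_orbit (e.symm ξ))

theorem UnitaryRep.conj_apply {G : Type*} [Group G] [TopologicalSpace G]
    {E F : Type*} [NormedAddCommGroup E] [InnerProductSpace ℂ E] [NormedAddCommGroup F]
    [InnerProductSpace ℂ F] (π : UnitaryRep G F) (e : F ≃ₗᵢ[ℂ] E) (g : G) (ξ : E) :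
    (π.conj e).toHom g ξ = e (π.toHom g (e.symm ξ)) := rfl

theorem UnitaryRep.HasAlmostInvariantVectors.conj {G : Type*} [Group G] [TopologicalSpace G]
    {E F : Type*} [NormedAddCommGroup E] [InnerProductSpace ℂ E] [NormedAddCommGroup F]
    [InnerProductSpace ℂ F] {π : UnitaryRep G F} (hπ : π.HasAlmostInvariantVectors)
    (e : F ≃ₗᵢ[ℂ] E) : (π.conj e).HasAlmostInvariantVectors := by
  intro ε hε S hS
  obtain ⟨ξ, h1, h2⟩ := hπ ε hε S hS
  refine ⟨e ξ, by rw [e.norm_map, h1], fun g hg => ?_⟩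
  rw [UnitaryRep.conj_apply, e.symm_apply_apply, ← map_sub, e.norm_map]
  exact h2 g hg

/-- The pullback of a unitary representation along a continuous homomorphism. -/
def UnitaryRep.comp {G Q : Type*} [Group G] [TopologicalSpace G] [Group Q] [TopologicalSpace Q]
    {E : Type*} [NormedAddCommGroup E] [InnerProductSpace ℂ E] (σ : UnitaryRep Q E) (f : G →* Q)
    (hf : Continuous f) : UnitaryRep G E where
  toHom := σ.toHom.comp f
  continuous_orbit ξ := (σ.continuous_orbit ξ).comp hf

theorem UnitaryRep.HasAlmostInvariantVectors.comp {G Q : Type*} [Group G] [TopologicalSpace G]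
    [Group Q] [TopologicalSpace Q] {E : Type*} [NormedAddCommGroup E] [InnerProductSpace ℂ E]
    {σ : UnitaryRep Q E} (hσ : σ.HasAlmostInvariantVectors) (f : G →* Q) (hf : Continuous f) :
    (σ.comp f hf).HasAlmostInvariantVectors := by
  intro ε hε S hS
  obtain ⟨ξ, h1, h2⟩ := hσ ε hε (f '' S) (hS.image hf)
  exact ⟨ξ, h1, fun g hg => h2 (f g) ⟨g, hg, rfl⟩⟩

/-- The resolution property applies to separable Hilbert spaces in every universe. -/
theorem IsResolution.exists_linearIsometry {G : Type u} {Q : Type v} [Group G] [TopologicalSpace G]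
    [Group Q] [TopologicalSpace Q] {p : G →* Q} (hp : IsResolution.{u, v, w} p)
    {F : Type*} [NormedAddCommGroup F] [InnerProductSpace ℂ F] [CompleteSpace F]
    [TopologicalSpace.SeparableSpace F] (π : UnitaryRep G F) (hπ : π.HasAlmostInvariantVectors) :
    ∃ (K : Type w) (_ : NormedAddCommGroup K) (_ : InnerProductSpace ℂ K) (_ : CompleteSpace K)
      (J : K →ₗᵢ[ℂ] F) (σ : UnitaryRep Q K), σ.HasAlmostInvariantVectors ∧
        ∀ g ξ, J (σ.toHom (p g) ξ) = π.toHom g (J ξ) := by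
  -- `IsResolution` only quantifies over Hilbert spaces in the universe `w`, so the representation
  -- is moved there and the result moved back.
  obtain ⟨E, _, _, _, ⟨e⟩⟩ := exists_linearIsometryEquiv_universe.{_, w} F
  obtain ⟨K, hK, σ, hσ, h⟩ := hp.2.2 E (π.conj e) (hπ.conj e)
  refine ⟨K, inferInstance, inferInstance, hK.completeSpace_coe,
    e.symm.toLinearIsometry.comp K.subtypeₗᵢ, σ, hσ, fun g ξ => ?_⟩
  change e.symm ((σ.toHom (p g) ξ : K) : E) = π.toHom g (e.symm ξ)
  rw [h, UnitaryRep.conj_apply, e.symm_apply_apply]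

/-! ### Multiplier representations on `L²` -/

/-- A measurable action of a group on a measure space together with a cocycle whose squared modulus
is the Radon–Nikodym cocycle. -/
structure MultiplierAction (G : Type*) [Group G] {X : Type*} [MeasurableSpace X]
    (ν : Measure X) where
  /-- the action -/
  act : G → X → X
  measurable_act : ∀ g, Measurable (act g)
  act_one : ∀ x, act 1 x = x
  act_mul : ∀ g h x, act (g * h) x = act g (act h x)
  /-- the cocycle -/
  mult : G → X → ℂ
  measurable_mult : ∀ g, Measurable (mult g)
  mult_one : ∀ᵐ x ∂ν, mult 1 x = 1
  mult_mul : ∀ g h, ∀ᵐ x ∂ν, mult (g * h) x = mult g x * mult h (act g⁻¹ x)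
  withDensity_mult : ∀ g, ν.withDensity (fun x => ‖mult g x‖ₑ ^ 2) = ν.map (act g)

namespace MultiplierAction

variable {G : Type*} [Group G] {X : Type*} [MeasurableSpace X] {ν : Measure X}
  (S : MultiplierAction G ν)

theorem quasiMeasurePreserving (g : G) : Measure.QuasiMeasurePreserving (S.act g) ν ν :=
  ⟨S.measurable_act g, by
    rw [← S.withDensity_mult]; exact withDensity_absolutelyContinuous _ _⟩

theorem act_inv_act (g : G) (x : X) : S.act g⁻¹ (S.act g x) = x := by
  rw [← S.act_mul, inv_mul_cancel, S.act_one]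

/-- Change of variables: the squared modulus of the multiplier is the density of the image of `ν`
under `g`. -/
theorem eLpNorm_mult_comp (g : G) {f : X → ℂ} (hf : AEStronglyMeasurable f ν) :
    eLpNorm (fun x => S.mult g x * f (S.act g⁻¹ x)) 2 ν = eLpNorm f 2 ν := by
  have h2 : AEStronglyMeasurable (fun x => f (S.act g⁻¹ x)) ν :=
    hf.comp_quasiMeasurePreserving (S.quasiMeasurePreserving g⁻¹)
  have h : ∫⁻ x, ‖S.mult g x * f (S.act g⁻¹ x)‖ₑ ^ 2 ∂ν = ∫⁻ x, ‖f x‖ₑ ^ 2 ∂ν := by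
    have h3 : AEMeasurable (fun x => ‖f (S.act g⁻¹ x)‖ₑ ^ 2) ν := h2.enorm.pow_const 2
    have h4 : AEMeasurable (fun x => ‖f (S.act g⁻¹ x)‖ₑ ^ 2) (ν.map (S.act g)) :=
      h3.mono_ac (S.quasiMeasurePreserving g).absolutelyContinuous
    simp_rw [enorm_mul, mul_pow]
    refine (lintegral_withDensity_eq_lintegral_mul₀
      ((S.measurable_mult g).enorm.pow_const 2).aemeasurable h3).symm.trans ?_
    rw [S.withDensity_mult, lintegral_map' h4 (S.measurable_act g).aemeasurable]
    simp_rw [S.act_inv_act]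
  rw [eLpNorm_eq_lintegral_rpow_enorm_toReal two_ne_zero ENNReal.ofNat_ne_top,
    eLpNorm_eq_lintegral_rpow_enorm_toReal two_ne_zero ENNReal.ofNat_ne_top]
  simp only [ENNReal.toReal_ofNat, ENNReal.rpow_ofNat]
  rw [h]

theorem memLp_mult_comp (g : G) {f : X → ℂ} (hf : MemLp f 2 ν) :
    MemLp (fun x => S.mult g x * f (S.act g⁻¹ x)) 2 ν :=
  ⟨(S.measurable_mult g).aestronglyMeasurable.mul
    (hf.1.comp_quasiMeasurePreserving (S.quasiMeasurePreserving g⁻¹)), by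
    rw [S.eLpNorm_mult_comp g hf.1]; exact hf.2⟩

/-- The isometry `f ↦ c(g, ·) f(g⁻¹ ·)` of `L²`. -/
def isometry (g : G) : Lp ℂ 2 ν →ₗᵢ[ℂ] Lp ℂ 2 ν where
  toFun f := (S.memLp_mult_comp g (Lp.memLp f)).toLp _
  map_add' f f' := by
    rw [← MemLp.toLp_add, MemLp.toLp_eq_toLp_iff]
    filter_upwards [(S.quasiMeasurePreserving g⁻¹).ae (Lp.coeFn_add f f')] with x hx
    simp only [hx, Pi.add_apply, mul_add]
  map_smul' c f := by
    rw [RingHom.id_apply, ← MemLp.toLp_const_smul, MemLp.toLp_eq_toLp_iff]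
    filter_upwards [(S.quasiMeasurePreserving g⁻¹).ae (Lp.coeFn_smul c f)] with x hx
    simp only [hx, Pi.smul_apply, smul_eq_mul]
    ring
  norm_map' f := by
    change ‖(S.memLp_mult_comp g (Lp.memLp f)).toLp _‖ = _
    rw [Lp.norm_toLp, S.eLpNorm_mult_comp g (Lp.memLp f).1, Lp.norm_def]

theorem coeFn_isometry (g : G) (f : Lp ℂ 2 ν) :
    S.isometry g f =ᵐ[ν] fun x => S.mult g x * f (S.act g⁻¹ x) :=
  (S.memLp_mult_comp g (Lp.memLp f)).coeFn_toLp

theorem isometry_one (f : Lp ℂ 2 ν) : S.isometry 1 f = f := by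
  refine Lp.ext ?_
  filter_upwards [S.coeFn_isometry 1 f, S.mult_one] with x h1 h2
  rw [h1, h2, inv_one, S.act_one, one_mul]

theorem isometry_mul (g h : G) (f : Lp ℂ 2 ν) :
    S.isometry (g * h) f = S.isometry g (S.isometry h f) := by
  refine Lp.ext ?_
  filter_upwards [S.coeFn_isometry (g * h) f, S.coeFn_isometry g (S.isometry h f),
    (S.quasiMeasurePreserving g⁻¹).ae (S.coeFn_isometry h f), S.mult_mul g h] with x h1 h2 h3 h4
  rw [h1, h2, h3, h4, mul_inv_rev, S.act_mul, mul_assoc]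

/-- The unitary representation of a discrete group on `L²` given by a multiplier action. -/
def unitaryRep [TopologicalSpace G] [DiscreteTopology G] : UnitaryRep G (Lp ℂ 2 ν) where
  toHom :=
    { toFun g :=
        { toLinearEquiv := LinearEquiv.ofLinearMap (S.isometry g).toLinearMap
            (S.isometry g⁻¹).toLinearMap
            (LinearMap.ext fun f => by
              change S.isometry g (S.isometry g⁻¹ f) = f
              rw [← S.isometry_mul, mul_inv_cancel, S.isometry_one])
            (LinearMap.ext fun f => by
              change S.isometry g⁻¹ (S.isometry g f) = f
              rw [← S.isometry_mul, inv_mul_cancel, S.isometry_one])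
          norm_map' := (S.isometry g).norm_map }
      map_one' := LinearIsometryEquiv.ext fun f => S.isometry_one f
      map_mul' g h := LinearIsometryEquiv.ext fun f => S.isometry_mul g h f }
  continuous_orbit _ := continuous_of_discreteTopology

theorem coeFn_unitaryRep [TopologicalSpace G] [DiscreteTopology G] (g : G) (f : Lp ℂ 2 ν) :
    S.unitaryRep.toHom g f =ᵐ[ν] fun x => S.mult g x * f (S.act g⁻¹ x) :=
  S.coeFn_isometry g f

end MultiplierAction

/-! ### Densities and the norm distance of measures -/

theorem map_withDensity_of_leftInverse {X : Type*} [MeasurableSpace X] {T S : X → X}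
    (hT : Measurable T) (hS : Measurable S) (hST : Function.LeftInverse S T) (ν : Measure X)
    {r : X → ENNReal} (hr : Measurable r) :
    (ν.withDensity r).map T = (ν.map T).withDensity fun x => r (S x) := by
  ext s hs
  rw [Measure.map_apply hT hs, withDensity_apply _ (hT hs), withDensity_apply _ hs,
    setLIntegral_map (f := fun x => r (S x)) hs (hr.comp hS) hT]
  simp_rw [hST _]

/-- The Radon–Nikodym cocycle identity. -/
theorem rnDeriv_map_ae_eq {X : Type*} [MeasurableSpace X] {T S : X → X}
    (hT : Measurable T) (hS : Measurable S) (hST : Function.LeftInverse S T) (m ν : Measure X)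
    [IsFiniteMeasure m] [IsFiniteMeasure ν] (hm : m ≪ ν) (hν : ν.map T ≪ ν) :
    (m.map T).rnDeriv ν =ᵐ[ν] fun x => (ν.map T).rnDeriv ν x * m.rnDeriv ν (S x) := by
  have h1 : m.map T = ν.withDensity fun x => (ν.map T).rnDeriv ν x * m.rnDeriv ν (S x) := by
    conv_lhs => rw [← Measure.withDensity_rnDeriv_eq m ν hm]
    rw [map_withDensity_of_leftInverse hT hS hST ν (Measure.measurable_rnDeriv m ν)]
    conv_lhs => rw [← Measure.withDensity_rnDeriv_eq (ν.map T) ν hν]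
    exact (withDensity_mul ν (Measure.measurable_rnDeriv _ ν)
      ((Measure.measurable_rnDeriv m ν).comp hS)).symm
  rw [h1]
  exact Measure.rnDeriv_withDensity ν ((Measure.measurable_rnDeriv _ ν).mul
    ((Measure.measurable_rnDeriv m ν).comp hS))

/-- Without this bound the real `sSup` would take its default value `0`. -/
theorem measureNormDist_bddAbove {X : Type*} [MeasurableSpace X] (μ ν : Measure X)
    [IsFiniteMeasure μ] [IsFiniteMeasure ν] :
    BddAbove {r : ℝ | ∃ f : X → ℂ, Measurable f ∧ (∀ x, ‖f x‖ ≤ 1) ∧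
      r = ‖(∫ x, f x ∂μ) - ∫ x, f x ∂ν‖} := by
  refine ⟨1 * μ.real Set.univ + 1 * ν.real Set.univ, ?_⟩
  rintro _ ⟨f, -, hf, rfl⟩
  exact (norm_sub_le _ _).trans (add_le_add
    (norm_integral_le_of_norm_le_const (Eventually.of_forall hf))
    (norm_integral_le_of_norm_le_const (Eventually.of_forall hf)))

theorem le_measureNormDist {X : Type*} [MeasurableSpace X] (μ ν : Measure X)
    [IsFiniteMeasure μ] [IsFiniteMeasure ν] {f : X → ℂ} (hf : Measurable f)
    (hf1 : ∀ x, ‖f x‖ ≤ 1) : ‖(∫ x, f x ∂μ) - ∫ x, f x ∂ν‖ ≤ measureNormDist μ ν :=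
  le_csSup (measureNormDist_bddAbove μ ν) ⟨f, hf, hf1, rfl⟩

theorem measureNormDist_restrict_le {X : Type*} [MeasurableSpace X] (μ ν : Measure X)
    [IsFiniteMeasure μ] [IsFiniteMeasure ν] {C : Set X} (hC : MeasurableSet C) :
    measureNormDist (μ.restrict C) (ν.restrict C) ≤ measureNormDist μ ν := by
  refine csSup_le ⟨_, 0, measurable_const, by simp, rfl⟩ ?_
  rintro _ ⟨f, hf, hf1, rfl⟩
  rw [← integral_indicator hC, ← integral_indicator hC]
  refine le_measureNormDist μ ν (hf.indicator hC) fun x => ?_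
  exact (norm_indicator_le_norm_self f x).trans (hf1 x)

/-- The sign of the difference of the densities is an admissible test function, and it attains the
left side. -/
theorem integral_abs_rnDeriv_sub_le {X : Type*} [MeasurableSpace X] (m₁ m₂ ν : Measure X)
    [IsFiniteMeasure m₁] [IsFiniteMeasure m₂] [IsFiniteMeasure ν] (h₁ : m₁ ≪ ν) (h₂ : m₂ ≪ ν) :
    ∫ x, |(m₁.rnDeriv ν x).toReal - (m₂.rnDeriv ν x).toReal| ∂ν ≤ measureNormDist m₁ m₂ := by
  let p : X → ℝ := fun x => (m₁.rnDeriv ν x).toReal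
  let q : X → ℝ := fun x => (m₂.rnDeriv ν x).toReal
  have hp : Measurable p := (Measure.measurable_rnDeriv m₁ ν).ennreal_toReal
  have hq : Measurable q := (Measure.measurable_rnDeriv m₂ ν).ennreal_toReal
  have hs : MeasurableSet {x | q x ≤ p x} := measurableSet_le hq hp
  classical
  let f : X → ℂ := fun x => if q x ≤ p x then 1 else -1
  have hf : Measurable f := Measurable.ite hs measurable_const measurable_const
  have hf1 : ∀ x, ‖f x‖ ≤ 1 := fun x => by simp only [f]; split_ifs <;> simp
  have key : ∀ m : Measure X, IsFiniteMeasure m → m ≪ ν →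
      ∫ x, f x ∂m = ∫ x, (m.rnDeriv ν x).toReal • f x ∂ν := fun m _ hm =>
    (integral_rnDeriv_smul hm).symm
  have hi : ∀ m : Measure X, IsFiniteMeasure m → m ≪ ν →
      Integrable (fun x => (m.rnDeriv ν x).toReal • f x) ν := fun m _ hm =>
    (integrable_rnDeriv_smul_iff hm).2
      (Integrable.of_bound hf.aestronglyMeasurable 1 (Eventually.of_forall hf1))
  refine le_trans (le_of_eq ?_) (le_measureNormDist m₁ m₂ hf hf1)
  rw [key m₁ inferInstance h₁, key m₂ inferInstance h₂,
    ← integral_sub (hi m₁ inferInstance h₁) (hi m₂ inferInstance h₂)]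
  have h3 : ∀ x, (m₁.rnDeriv ν x).toReal • f x - (m₂.rnDeriv ν x).toReal • f x =
      ((|(m₁.rnDeriv ν x).toReal - (m₂.rnDeriv ν x).toReal| : ℝ) : ℂ) := by
    intro x
    change p x • f x - q x • f x = ((|p x - q x| : ℝ) : ℂ)
    simp only [f]
    split_ifs with h
    · rw [abs_of_nonneg (sub_nonneg.2 h)]; simp
    · rw [abs_of_neg (sub_neg.2 (not_le.1 h))]; simp; ring
  simp_rw [h3]
  rw [integral_complex_ofReal, Complex.norm_real, Real.norm_of_nonneg]
  exact integral_nonneg fun x => abs_nonneg _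

/-- The square root of the density of a finite measure, as a vector in `L²`. -/
def sqrtDensity {X : Type*} [MeasurableSpace X] (m ν : Measure X) [IsFiniteMeasure m] :
    Lp ℂ 2 ν :=
  MemLp.toLp (fun x => ((√(m.rnDeriv ν x).toReal : ℝ) : ℂ)) (by
    have hm : Measurable fun x => ((√(m.rnDeriv ν x).toReal : ℝ) : ℂ) :=
      Complex.measurable_ofReal.comp (Measure.measurable_rnDeriv m ν).ennreal_toReal.sqrt
    rw [memLp_two_iff_integrable_sq_norm hm.aestronglyMeasurable]
    refine (Measure.integrable_toReal_rnDeriv (μ := m) (ν := ν)).congr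
      (Eventually.of_forall fun x => ?_)
    simp [Real.sq_sqrt])

theorem coeFn_sqrtDensity {X : Type*} [MeasurableSpace X] (m ν : Measure X) [IsFiniteMeasure m] :
    sqrtDensity m ν =ᵐ[ν] fun x => ((√(m.rnDeriv ν x).toReal : ℝ) : ℂ) :=
  MemLp.coeFn_toLp _

theorem norm_sqrtDensity_sq {X : Type*} [MeasurableSpace X] (m ν : Measure X) [IsFiniteMeasure m]
    [SigmaFinite ν] (hm : m ≪ ν) : ‖sqrtDensity m ν‖ ^ 2 = m.real Set.univ := by
  rw [Lp_two_norm_sq, ← Measure.integral_toReal_rnDeriv hm]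
  refine integral_congr_ae ?_
  filter_upwards [coeFn_sqrtDensity m ν] with x hx
  rw [hx, Complex.norm_real, Real.norm_of_nonneg (Real.sqrt_nonneg _),
    Real.sq_sqrt ENNReal.toReal_nonneg]

theorem sq_sqrt_sub_sqrt_le {p q : ℝ} (hp : 0 ≤ p) (hq : 0 ≤ q) : (√p - √q) ^ 2 ≤ |p - q| := by
  have h1 : |p - q| = |√p - √q| * (√p + √q) := by
    rw [← abs_of_nonneg (add_nonneg (Real.sqrt_nonneg p) (Real.sqrt_nonneg q)), ← abs_mul]
    congr 1
    nlinarith [Real.sq_sqrt hp, Real.sq_sqrt hq]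
  rw [h1, ← sq_abs, sq]
  refine mul_le_mul_of_nonneg_left ?_ (abs_nonneg _)
  rw [abs_le]
  constructor <;> linarith [Real.sqrt_nonneg p, Real.sqrt_nonneg q]

theorem norm_sqrtDensity_sub_sq_le {X : Type*} [MeasurableSpace X] (m₁ m₂ ν : Measure X)
    [IsFiniteMeasure m₁] [IsFiniteMeasure m₂] [IsFiniteMeasure ν] (h₁ : m₁ ≪ ν) (h₂ : m₂ ≪ ν) :
    ‖sqrtDensity m₁ ν - sqrtDensity m₂ ν‖ ^ 2 ≤ measureNormDist m₁ m₂ := by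
  refine le_trans ?_ (integral_abs_rnDeriv_sub_le m₁ m₂ ν h₁ h₂)
  rw [Lp_two_norm_sq]
  refine integral_mono_ae (Lp_two_integrable_sq _)
    (Measure.integrable_toReal_rnDeriv.sub Measure.integrable_toReal_rnDeriv).abs ?_
  filter_upwards [Lp.coeFn_sub (sqrtDensity m₁ ν) (sqrtDensity m₂ ν), coeFn_sqrtDensity m₁ ν,
    coeFn_sqrtDensity m₂ ν] with x h1 h2 h3
  rw [h1, Pi.sub_apply, h2, h3, ← Complex.ofReal_sub, Complex.norm_real, Real.norm_eq_abs, sq_abs]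
  exact sq_sqrt_sub_sqrt_le ENNReal.toReal_nonneg ENNReal.toReal_nonneg

/-! ### The Koopman representation on the dual group -/

theorem PontryaginDual.continuous_eval {N : Type*} [Monoid N] [TopologicalSpace N] (a : N) :
    Continuous fun χ : PontryaginDual N => χ a :=
  (continuous_eval_const (F := C(N, Circle)) a).comp
    (ContinuousMonoidHom.isInducing_toContinuousMap N Circle).continuous

theorem PontryaginDual.continuous_coe_eval {N : Type*} [Monoid N] [TopologicalSpace N] (a : N) :
    Continuous fun χ : PontryaginDual N => (χ a : ℂ) :=
  continuous_subtype_val.comp (PontryaginDual.continuous_eval a)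

theorem enorm_sqrt_toReal_sq {t : ENNReal} (ht : t ≠ ⊤) :
    ‖((√t.toReal : ℝ) : ℂ)‖ₑ ^ 2 = t := by
  rw [← ofReal_norm, Complex.norm_real, Real.norm_of_nonneg (Real.sqrt_nonneg _),
    ← ENNReal.ofReal_pow (Real.sqrt_nonneg _), Real.sq_sqrt ENNReal.toReal_nonneg,
    ENNReal.ofReal_toReal ht]

section Koopman

variable {Γ : Type*} [Group Γ] {N : Type*} [CommGroup N] [TopologicalSpace N]
  (ψ : Γ →* MulAut N) (hψ : ∀ γ, Continuous (ψ γ))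

theorem dualAction_one (χ : PontryaginDual N) : dualAction ψ hψ 1 χ = χ := by
  refine PontryaginDual.ext fun a => ?_
  change χ (ψ 1⁻¹ a) = χ a
  simp

theorem dualAction_mul (γ δ : Γ) (χ : PontryaginDual N) :
    dualAction ψ hψ (γ * δ) χ = dualAction ψ hψ γ (dualAction ψ hψ δ χ) := by
  refine PontryaginDual.ext fun a => ?_
  change χ (ψ (γ * δ)⁻¹ a) = χ (ψ δ⁻¹ (ψ γ⁻¹ a))
  simp

theorem dualAction_inv_apply (γ : Γ) (χ : PontryaginDual N) (a : N) :
    dualAction ψ hψ γ⁻¹ χ a = χ (ψ γ a) := by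
  change χ (ψ γ⁻¹⁻¹ a) = χ (ψ γ a)
  simp

theorem dualAction_leftInverse (γ : Γ) :
    Function.LeftInverse (dualAction ψ hψ γ⁻¹) (dualAction ψ hψ γ) := fun χ => by
  rw [← dualAction_mul, inv_mul_cancel, dualAction_one]

theorem measurable_dualAction (γ : Γ) : Measurable (dualAction ψ hψ γ) :=
  (map_continuous (dualAction ψ hψ γ)).measurable

theorem map_dualAction_mul (γ δ : Γ) (m : Measure (PontryaginDual N)) :
    m.map (dualAction ψ hψ (γ * δ)) = (m.map (dualAction ψ hψ δ)).map (dualAction ψ hψ γ) := by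
  rw [Measure.map_map (measurable_dualAction ψ hψ γ) (measurable_dualAction ψ hψ δ)]
  congr 1
  ext1 χ
  exact dualAction_mul ψ hψ γ δ χ

/-- The multiplier action of a semidirect product `N ⋊ Γ` on the dual of `N` with a
`Γ`-quasi-invariant measure: `N` acts by multiplication by characters and `Γ` by the Koopman
representation. -/
def koopman (ν : Measure (PontryaginDual N)) [IsFiniteMeasure ν]
    (hν : ∀ γ, ν.map (dualAction ψ hψ γ) ≪ ν) : MultiplierAction (N ⋊[ψ] Γ) ν where
  act g := dualAction ψ hψ g.right
  measurable_act g := measurable_dualAction ψ hψ g.right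
  act_one χ := dualAction_one ψ hψ χ
  act_mul g h χ := dualAction_mul ψ hψ g.right h.right χ
  mult g χ := χ g.left * ((√((ν.map (dualAction ψ hψ g.right)).rnDeriv ν χ).toReal : ℝ) : ℂ)
  measurable_mult g := (PontryaginDual.continuous_coe_eval g.left).measurable.mul
    (Complex.measurable_ofReal.comp (Measure.measurable_rnDeriv _ ν).ennreal_toReal.sqrt)
  mult_one := by
    have h1 : ν.map (dualAction ψ hψ 1) = ν := by
      have : (dualAction ψ hψ 1 : PontryaginDual N → PontryaginDual N) = id :=
        funext (dualAction_one ψ hψ)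
      rw [this, Measure.map_id]
    filter_upwards [Measure.rnDeriv_self ν] with χ hχ
    rw [SemidirectProduct.one_right, h1, hχ, SemidirectProduct.one_left, map_one]
    simp
  mult_mul g h := by
    have h1 := rnDeriv_map_ae_eq (measurable_dualAction ψ hψ g.right)
      (measurable_dualAction ψ hψ g.right⁻¹) (dualAction_leftInverse ψ hψ g.right)
      (ν.map (dualAction ψ hψ h.right)) ν (hν _) (hν _)
    rw [← map_dualAction_mul] at h1
    filter_upwards [h1] with χ hχ
    rw [SemidirectProduct.mul_right, hχ, SemidirectProduct.mul_left, SemidirectProduct.inv_right,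
      dualAction_inv_apply, map_mul, ENNReal.toReal_mul, Real.sqrt_mul ENNReal.toReal_nonneg]
    push_cast
    ring
  withDensity_mult g := by
    conv_rhs => rw [← Measure.withDensity_rnDeriv_eq _ ν (hν g.right)]
    refine withDensity_congr_ae ?_
    filter_upwards [Measure.rnDeriv_lt_top (ν.map (dualAction ψ hψ g.right)) ν] with χ hχ
    rw [enorm_mul, mul_pow, enorm_sqrt_toReal_sq hχ.ne, ← ofReal_norm, Circle.norm_coe,
      ENNReal.ofReal_one, one_pow, one_mul]

variable [TopologicalSpace Γ] [DiscreteTopology (N ⋊[ψ] Γ)]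
  (ν : Measure (PontryaginDual N)) [IsFiniteMeasure ν]
  (hν : ∀ γ, ν.map (dualAction ψ hψ γ) ≪ ν)

theorem coeFn_koopman_inl (a : N) (f : Lp ℂ 2 ν) :
    (koopman ψ hψ ν hν).unitaryRep.toHom (SemidirectProduct.inl a) f =ᵐ[ν]
      fun χ => (χ a : ℂ) * f χ := by
  filter_upwards [(koopman ψ hψ ν hν).coeFn_unitaryRep (SemidirectProduct.inl a) f,
    (koopman ψ hψ ν hν).mult_one] with χ e1 e2
  rw [e1]
  have e3 : (koopman ψ hψ ν hν).act (SemidirectProduct.inl a)⁻¹ χ = χ := by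
    change dualAction ψ hψ 1⁻¹ χ = χ
    rw [inv_one, dualAction_one]
  have e4 : (koopman ψ hψ ν hν).mult (SemidirectProduct.inl a) χ =
      χ a * (koopman ψ hψ ν hν).mult 1 χ := by
    change (χ a : ℂ) * _ = χ a * ((χ 1 : ℂ) * _)
    rw [map_one, Circle.coe_one, one_mul]
    rfl
  rw [e3, e4, e2, mul_one]

/-- Square roots of densities transform as half-densities: this is the square root of the
Radon–Nikodym cocycle identity. It turns asymptotic invariance of measures into almost invariance of
vectors. -/
theorem koopman_inr_sqrtDensity (γ : Γ) (m : Measure (PontryaginDual N)) [IsFiniteMeasure m]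
    (hm : m ≪ ν) :
    (koopman ψ hψ ν hν).unitaryRep.toHom (SemidirectProduct.inr γ) (sqrtDensity m ν) =
      sqrtDensity (m.map (dualAction ψ hψ γ)) ν := by
  refine Lp.ext ?_
  have h1 := rnDeriv_map_ae_eq (measurable_dualAction ψ hψ γ)
      (measurable_dualAction ψ hψ γ⁻¹) (dualAction_leftInverse ψ hψ γ) m ν hm (hν _)
  filter_upwards [(koopman ψ hψ ν hν).coeFn_unitaryRep (SemidirectProduct.inr γ) (sqrtDensity m ν),
    coeFn_sqrtDensity (m.map (dualAction ψ hψ γ)) ν, h1,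
    ((koopman ψ hψ ν hν).quasiMeasurePreserving (SemidirectProduct.inr γ)⁻¹).ae
      (coeFn_sqrtDensity m ν)] with χ e1 e2 e3 e4
  rw [e1, e2, e3, e4]
  change (χ 1 : ℂ) * ((√((ν.map (dualAction ψ hψ γ)).rnDeriv ν χ).toReal : ℝ) : ℂ) *
    ((√(m.rnDeriv ν (dualAction ψ hψ γ⁻¹ χ)).toReal : ℝ) : ℂ) = _
  rw [map_one, ENNReal.toReal_mul, Real.sqrt_mul ENNReal.toReal_nonneg]
  push_cast
  ring

theorem norm_koopman_inl_sub_sq (a : N) (m : Measure (PontryaginDual N)) [IsFiniteMeasure m]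
    (hm : m ≪ ν) :
    ‖(koopman ψ hψ ν hν).unitaryRep.toHom (SemidirectProduct.inl a) (sqrtDensity m ν) -
      sqrtDensity m ν‖ ^ 2 = ∫ χ, ‖(χ a : ℂ) - 1‖ ^ 2 ∂m := by
  rw [Lp_two_norm_sq, ← integral_rnDeriv_smul hm]
  refine integral_congr_ae ?_
  filter_upwards [Lp.coeFn_sub ((koopman ψ hψ ν hν).unitaryRep.toHom (SemidirectProduct.inl a)
    (sqrtDensity m ν)) (sqrtDensity m ν), coeFn_koopman_inl ψ hψ ν hν a (sqrtDensity m ν),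
    coeFn_sqrtDensity m ν] with χ e1 e2 e3
  rw [e1, Pi.sub_apply, e2, e3, ← sub_one_mul, norm_mul, mul_pow, Complex.norm_real,
    Real.norm_of_nonneg (Real.sqrt_nonneg _), Real.sq_sqrt ENNReal.toReal_nonneg, smul_eq_mul,
    mul_comm]

theorem norm_koopman_sub_le (g : N ⋊[ψ] Γ) (m : Measure (PontryaginDual N)) [IsFiniteMeasure m]
    (hm : m ≪ ν) :
    ‖(koopman ψ hψ ν hν).unitaryRep.toHom g (sqrtDensity m ν) - sqrtDensity m ν‖ ≤
      √(measureNormDist (m.map (dualAction ψ hψ g.right)) m) +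
        √(∫ χ, ‖(χ g.left : ℂ) - 1‖ ^ 2 ∂m) := by
  let π := (koopman ψ hψ ν hν).unitaryRep
  let ξ := sqrtDensity m ν
  have h1 : π.toHom g ξ - ξ = π.toHom (SemidirectProduct.inl g.left)
      (π.toHom (SemidirectProduct.inr g.right) ξ - ξ) +
      (π.toHom (SemidirectProduct.inl g.left) ξ - ξ) := by
    conv_lhs => rw [← SemidirectProduct.inl_left_mul_inr_right g]
    rw [map_mul, map_sub]
    change π.toHom _ (π.toHom _ ξ) - ξ = _
    abel
  change ‖π.toHom g ξ - ξ‖ ≤ _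
  rw [h1]
  refine (norm_add_le _ _).trans (add_le_add ?_ ?_)
  · rw [LinearIsometryEquiv.norm_map]
    refine Real.le_sqrt_of_sq_le ?_
    simp only [π, ξ]
    rw [koopman_inr_sqrtDensity ψ hψ ν hν _ m hm]
    refine norm_sqrtDensity_sub_sq_le _ _ ν ?_ hm
    exact (hm.map (measurable_dualAction ψ hψ _)).trans (hν _)
  · exact Real.le_sqrt_of_sq_le (norm_koopman_inl_sub_sq ψ hψ ν hν _ m hm).le

/-- If there are finite measures of non-vanishing mass which are asymptotically `Γ`-invariant and
concentrate at the trivial character, then the Koopman representation has almost invariant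
vectors. -/
theorem koopman_hasAlmostInvariantVectors (m : ℕ → Measure (PontryaginDual N))
    [∀ n, IsFiniteMeasure (m n)] (hm : ∀ n, m n ≪ ν)
    {c : ℝ} (hc : 0 < c) (hmass : ∃ᶠ n in atTop, c ≤ (m n).real Set.univ)
    (hinv : ∀ γ, Tendsto (fun n => measureNormDist ((m n).map (dualAction ψ hψ γ)) (m n)) atTop
      (𝓝 0))
    (hone : ∀ a : N, Tendsto (fun n => ∫ χ, ‖(χ a : ℂ) - 1‖ ^ 2 ∂m n) atTop (𝓝 0)) :
    (koopman ψ hψ ν hν).unitaryRep.HasAlmostInvariantVectors := by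
  intro ε hε S hS
  have hfin : S.Finite := hS.finite_of_discrete
  -- Normalizing divides by `‖ξ‖ ≥ √c`, whence the threshold `ε * √c`.
  have hev : ∀ᶠ n in atTop, ∀ g ∈ S, ‖(koopman ψ hψ ν hν).unitaryRep.toHom g
      (sqrtDensity (m n) ν) - sqrtDensity (m n) ν‖ < ε * √c := by
    refine (eventually_all_finite hfin).2 fun g _ => ?_
    have h1 := (hinv g.right).sqrt.add (hone g.left).sqrt
    rw [Real.sqrt_zero, add_zero] at h1
    filter_upwards [h1.eventually_lt_const (show 0 < ε * √c by positivity)] with n hn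
    exact (norm_koopman_sub_le ψ hψ ν hν g (m n) (hm n)).trans_lt hn
  obtain ⟨n, hn, hnS⟩ := (hmass.and_eventually hev).exists
  let ξ := sqrtDensity (m n) ν
  have hξ : √c ≤ ‖ξ‖ := by
    rw [Real.sqrt_le_left (norm_nonneg _), norm_sqrtDensity_sq _ _ (hm n)]
    exact hn
  have hξ0 : 0 < ‖ξ‖ := (Real.sqrt_pos.2 hc).trans_le hξ
  refine ⟨((‖ξ‖⁻¹ : ℝ) : ℂ) • ξ, ?_, fun g hg => ?_⟩
  · rw [norm_smul, Complex.norm_real, norm_inv, norm_norm, inv_mul_cancel₀ hξ0.ne']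
  · rw [map_smul, ← smul_sub, norm_smul, Complex.norm_real, norm_inv, norm_norm,
      inv_mul_le_iff₀ hξ0]
    refine (hnS g hg).le.trans ?_
    rw [mul_comm]
    exact mul_le_mul_of_nonneg_right hξ hε.le

end Koopman

/-! ### Invariant hulls, quasi-invariant measures and weak convergence -/

section InvariantSets

variable {Γ : Type*} [Group Γ] {N : Type*} [CommGroup N] [TopologicalSpace N]
  (ψ : Γ →* MulAut N) (hψ : ∀ γ, Continuous (ψ γ))

/-- An invariant set has an invariant measurable hull. -/
theorem exists_invariant_hull [Countable Γ] (m : Measure (PontryaginDual N))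
    {s : Set (PontryaginDual N)} (hs : ∀ γ, ∀ χ ∈ s, dualAction ψ hψ γ χ ∈ s) :
    ∃ B, s ⊆ B ∧ MeasurableSet B ∧ m B = m s ∧ ∀ γ, dualAction ψ hψ γ ⁻¹' B = B := by
  let B : Set (PontryaginDual N) := ⋂ γ, dualAction ψ hψ γ ⁻¹' toMeasurable m s
  have hsB : s ⊆ B := fun χ hχ =>
    Set.mem_iInter.2 fun γ => subset_toMeasurable m s (hs γ χ hχ)
  refine ⟨B, hsB, ?_, le_antisymm ?_ (measure_mono hsB), fun γ => ?_⟩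
  · exact MeasurableSet.iInter fun γ =>
      measurable_dualAction ψ hψ γ (measurableSet_toMeasurable m s)
  · refine (measure_mono fun χ hχ => ?_).trans (measure_toMeasurable s).le
    have := Set.mem_iInter.1 hχ 1
    rwa [Set.mem_preimage, dualAction_one] at this
  · ext χ
    simp only [B, Set.mem_preimage, Set.mem_iInter]
    refine ⟨fun h δ => ?_, fun h δ => ?_⟩
    · have := h (δ * γ⁻¹)
      rwa [← dualAction_mul, inv_mul_cancel_right] at this
    · rw [← dualAction_mul]
      exact h _

/-- A countable family of measures is dominated by a quasi-invariant finite measure, which has no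
more null sets than necessary. -/
theorem exists_quasiInvariant_measure [Countable Γ] (m : ℕ → Measure (PontryaginDual N))
    [∀ n, IsFiniteMeasure (m n)] :
    ∃ ν : Measure (PontryaginDual N), IsFiniteMeasure ν ∧
      (∀ γ, ν.map (dualAction ψ hψ γ) ≪ ν) ∧ (∀ n, m n ≪ ν) ∧
      ∀ s, MeasurableSet s → (∀ n γ, (m n).map (dualAction ψ hψ γ) s = 0) → ν s = 0 := by
  -- The sum of all translates may be infinite, but it is s-finite, so `τ.toFinite` is a finite
  -- measure with the same null sets.
  let τ : Measure (PontryaginDual N) :=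
    Measure.sum fun i : ℕ × Γ => (m i.1).map (dualAction ψ hψ i.2)
  have h1 : τ ≪ τ.toFinite := absolutelyContinuous_toFinite τ
  have h2 : τ.toFinite ≪ τ := toFinite_absolutelyContinuous τ
  have hle : ∀ n γ, (m n).map (dualAction ψ hψ γ) ≪ τ := fun n γ =>
    (Measure.le_sum (fun i : ℕ × Γ => (m i.1).map (dualAction ψ hψ i.2))
      (n, γ)).absolutelyContinuous
  refine ⟨τ.toFinite, inferInstance, fun γ => ?_, fun n => ?_, fun s hs h => h2 ?_⟩
  · refine Measure.AbsolutelyContinuous.mk fun s hs h0 => ?_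
    rw [Measure.map_apply (measurable_dualAction ψ hψ γ) hs]
    refine h2 ((Measure.sum_apply_eq_zero).2 fun i => ?_)
    -- Translating the summand with index `(n, δ)` by `γ` gives the summand with index `(n, γ * δ)`.
    have h3 := (hle i.1 (γ * i.2)).trans h1 h0
    rwa [map_dualAction_mul, Measure.map_apply (measurable_dualAction ψ hψ γ) hs] at h3
  · have h3 := hle n 1
    have : (dualAction ψ hψ 1 : PontryaginDual N → PontryaginDual N) = id :=
      funext (dualAction_one ψ hψ)
    rw [this, Measure.map_id] at h3
    exact h3.trans h1
  · exact (Measure.sum_apply_eq_zero).2 fun i => h i.1 i.2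

theorem tendsto_integral_norm_char_sub_one_sq {μ : ℕ → ProbabilityMeasure (PontryaginDual N)}
    (hμ : Tendsto μ atTop (𝓝 (diracProba 1))) (a : N) :
    Tendsto (fun n => ∫ χ, ‖(χ a : ℂ) - 1‖ ^ 2 ∂(μ n : Measure (PontryaginDual N))) atTop
      (𝓝 0) := by
  have hc : Continuous fun χ : PontryaginDual N => ‖(χ a : ℂ) - 1‖ ^ 2 :=
    ((PontryaginDual.continuous_coe_eval a).sub continuous_const).norm.pow 2
  have hb : ∀ χ : PontryaginDual N, ‖(‖(χ a : ℂ) - 1‖ ^ 2)‖ ≤ 2 ^ 2 := fun χ => by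
    rw [norm_pow, norm_norm]
    refine pow_le_pow_left₀ (norm_nonneg _) ((norm_sub_le _ _).trans ?_) 2
    rw [Circle.norm_coe, norm_one]
    norm_num
  have h := ProbabilityMeasure.tendsto_iff_forall_integral_tendsto.1 hμ
    (BoundedContinuousFunction.ofNormedAddCommGroup _ hc (2 ^ 2) hb)
  simp only [BoundedContinuousFunction.coe_ofNormedAddCommGroup] at h
  have h0 : ∫ χ, ‖(χ a : ℂ) - 1‖ ^ 2 
      ∂((diracProba 1 : ProbabilityMeasure (PontryaginDual N)) : Measure (PontryaginDual N)) = 0 := by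
    change ∫ χ, ‖(χ a : ℂ) - 1‖ ^ 2 ∂(Measure.dirac (1 : PontryaginDual N)) = 0
    rw [integral_dirac' _ _ hc.stronglyMeasurable]
    simp
  rwa [h0] at h

/-- The only trace of weak convergence needed for the truncated measures; it survives truncation
because the integrand is non-negative. -/
theorem tendsto_setIntegral_norm_char_sub_one_sq {μ : ℕ → ProbabilityMeasure (PontryaginDual N)}
    (hμ : Tendsto μ atTop (𝓝 (diracProba 1))) (a : N) (C : ℕ → Set (PontryaginDual N)) :
    Tendsto (fun n => ∫ χ in C n, ‖(χ a : ℂ) - 1‖ ^ 2 ∂(μ n : Measure (PontryaginDual N))) atTop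
      (𝓝 0) := by
  refine squeeze_zero (fun n => integral_nonneg fun χ => by positivity) (fun n => ?_)
    (tendsto_integral_norm_char_sub_one_sq hμ a)
  refine setIntegral_le_integral ?_ (Eventually.of_forall fun χ => by positivity)
  refine Integrable.of_bound (((PontryaginDual.continuous_coe_eval a).sub
    continuous_const).norm.pow 2).aestronglyMeasurable (2 ^ 2) (Eventually.of_forall fun χ => ?_)
  rw [norm_pow, norm_norm]
  refine pow_le_pow_left₀ (norm_nonneg _) ((norm_sub_le _ _).trans ?_) 2
  rw [Circle.norm_coe, norm_one]
  norm_num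

end InvariantSets

/-! ### Semidirect products and resolutions -/

instance SemidirectProduct.instDiscreteTopology {N G : Type*} [Group N] [Group G]
    [TopologicalSpace N] [TopologicalSpace G] [DiscreteTopology N] [DiscreteTopology G]
    {φ : G →* MulAut N} : DiscreteTopology (N ⋊[φ] G) :=
  DiscreteTopology.of_continuous_injective
    (f := (SemidirectProduct.equivProd : N ⋊[φ] G ≃ N × G)) continuous_induced_dom
    SemidirectProduct.equivProd.injective

theorem SemidirectProduct.continuous_inl {N G : Type*} [Group N] [Group G]
    [TopologicalSpace N] [TopologicalSpace G] {φ : G →* MulAut N} :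
    Continuous (SemidirectProduct.inl : N →* N ⋊[φ] G) :=
  continuous_induced_rng.2 (continuous_id.prodMk continuous_const)

instance DiscreteCopy.instCountable {G : Type*} [Countable G] : Countable (DiscreteCopy G) :=
  inferInstanceAs (Countable G)

instance PontryaginDual.instSecondCountableTopology {N : Type*} [CommGroup N] [TopologicalSpace N]
    [DiscreteTopology N] [Countable N] : SecondCountableTopology (PontryaginDual N) :=
  (ContinuousMonoidHom.isInducing_toContinuousMap N Circle).secondCountableTopology

/-- If `A ⋊ Γ → H ⋊ Γ` is a resolution and the Koopman representation for a quasi-invariant measure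
on the dual of `A` has almost invariant vectors, then the measure does not vanish on the
restrictions of the characters in a neighbourhood of `1`. -/
theorem IsResolution.measure_image_dualRestrict_ne_zero
    {H : Type u} [CommGroup H] [TopologicalSpace H] [IsTopologicalGroup H]
    [LocallyCompactSpace H] [T2Space H]
    {Γ : Type v} [Group Γ] [TopologicalSpace Γ] [DiscreteTopology Γ]
    {φ : Γ →* MulAut H} {A : Subgroup H} [Countable A] (hAdense : Dense (A : Set H))
    {hA : ∀ γ, ∀ a ∈ A, φ γ a ∈ A}
    (hres : IsResolution.{max u v, max u v, w} (semidirectIncl φ A hA))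
    {ν : Measure (PontryaginDual (DiscreteCopy A))} [IsFiniteMeasure ν]
    {hψ : ∀ γ, Continuous (restrictAction φ A hA γ)}
    {hν : ∀ γ, ν.map (dualAction (restrictAction φ A hA) hψ γ) ≪ ν}
    (hinv : (koopman _ hψ ν hν).unitaryRep.HasAlmostInvariantVectors)
    {V : Set (PontryaginDual H)} (hV : V ∈ 𝓝 (1 : PontryaginDual H)) :
    ν (dualRestrict A '' V) ≠ 0 := by
  -- Used for the separability of `L²`, together with second countability of the dual of the
  -- countable discrete group.
  have : Fact ((2 : ENNReal) ≠ ⊤) := ⟨ENNReal.ofNat_ne_top⟩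
  obtain ⟨K, _, _, _, J, σ, hσ, hJ⟩ := hres.exists_linearIsometry _ hinv
  refine _root_.measure_image_dualRestrict_ne_zero A inferInstance hAdense ν J
    (σ.comp SemidirectProduct.inl SemidirectProduct.continuous_inl)
    (hσ.comp _ SemidirectProduct.continuous_inl) (fun a ξ => ?_) hV
  have h1 := hJ (SemidirectProduct.inl a) ξ
  have h2 : semidirectIncl φ A hA (SemidirectProduct.inl a) =
      SemidirectProduct.inl (discreteIncl A a) := SemidirectProduct.map_inl _ _ _ _
  rw [h2] at h1
  change J (σ.toHom (SemidirectProduct.inl (discreteIncl A a)) ξ) =ᵐ[ν] _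
  rw [h1]
  exact coeFn_koopman_inl _ hψ ν hν a (J ξ)

end

/-! ### Convergence of the measures of `p(V)` -/

theorem proposition2p3 {H : Type u} [CommGroup H] [TopologicalSpace H] [IsTopologicalGroup H]
    [LocallyCompactSpace H] [T2Space H]
    {Γ : Type v} [Group Γ] [Countable Γ] [TopologicalSpace Γ] [DiscreteTopology Γ]
    (φ : Γ →* MulAut H) (hφ : ∀ γ, Continuous (φ γ))
    (A : Subgroup H) (hAcount : Countable A) (hAdense : Dense (A : Set H))
    (hA : ∀ γ, ∀ a ∈ A, φ γ a ∈ A)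
    (hres : IsResolution.{max u v, max u v, w} (semidirectIncl φ A hA))
    (V : Set (PontryaginDual H)) (hV : V ∈ 𝓝 (1 : PontryaginDual H))
    (hVinv : ∀ γ, ∀ η ∈ V, dualAction φ hφ γ η ∈ V)
    (μ : ℕ → ProbabilityMeasure (PontryaginDual (DiscreteCopy A)))
    (hμ : Tendsto μ atTop (𝓝 (diracProba 1)))
    (hμinv : ∀ γ, Tendsto (fun n => measureNormDist
      ((μ n : Measure (PontryaginDual (DiscreteCopy A))).map
        (dualAction (restrictAction φ A hA) (fun _ => continuous_of_discreteTopology) γ))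
      (μ n : Measure (PontryaginDual (DiscreteCopy A)))) atTop (𝓝 0)) :
    Tendsto (fun n => (μ n : Measure (PontryaginDual (DiscreteCopy A))) (dualRestrict A '' V))
        atTop (𝓝 1) ∧
      Tendsto (fun n => (μ n : Measure (PontryaginDual (DiscreteCopy A)))
        (Set.range (dualRestrict A))) atTop (𝓝 1) := by
  have hψ : ∀ γ, Continuous (restrictAction φ A hA γ) := fun _ => continuous_of_discreteTopology
  let T := dualAction (restrictAction φ A hA) hψ
  have hT : ∀ γ, Measurable (T γ) := measurable_dualAction _ hψ
  have hpV : ∀ γ, ∀ χ ∈ dualRestrict A '' V, T γ χ ∈ dualRestrict A '' V := by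
    rintro γ _ ⟨η, hη, rfl⟩
    exact ⟨dualAction φ hφ γ η, hVinv γ η hη, rfl⟩
  have key : Tendsto (fun n => (μ n : Measure (PontryaginDual (DiscreteCopy A)))
      (dualRestrict A '' V)) atTop (𝓝 1) := by
    refine tendsto_order.2 ⟨fun a ha => ?_, fun a ha => Eventually.of_forall fun n =>
      prob_le_one.trans_lt ha⟩
    by_contra hnot
    have hfreq : ∃ᶠ n in atTop, (μ n : Measure (PontryaginDual (DiscreteCopy A)))
        (dualRestrict A '' V) ≤ a := by
      simpa only [Filter.Frequently, not_le] using hnot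
    choose B hVB hBm hμB hBinv using fun n => exists_invariant_hull (restrictAction φ A hA) hψ
      (μ n : Measure (PontryaginDual (DiscreteCopy A))) hpV
    let m : ℕ → Measure (PontryaginDual (DiscreteCopy A)) := fun n =>
      (μ n : Measure (PontryaginDual (DiscreteCopy A))).restrict (B n)ᶜ
    -- Invariance of `B n` makes restriction commute with the action, so truncation does not spoil
    -- asymptotic invariance.
    have hmap : ∀ n γ, (m n).map (T γ) =
        ((μ n : Measure (PontryaginDual (DiscreteCopy A))).map (T γ)).restrict (B n)ᶜ := by
      intro n γ
      rw [Measure.restrict_map (hT γ) (hBm n).compl, Set.preimage_compl, hBinv n γ]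
    obtain ⟨ν, _, hν, hmν, hnull⟩ := exists_quasiInvariant_measure (restrictAction φ A hA) hψ m
    -- `p(V)` lies in the intersection of all `B n`, and every translate of `m n` vanishes on `B n`.
    have hνV : ν (dualRestrict A '' V) = 0 := by
      refine measure_mono_null (Set.subset_iInter hVB)
        (hnull _ (MeasurableSet.iInter hBm) fun n γ => ?_)
      refine measure_mono_null (Set.iInter_subset B n) ?_
      change (m n).map (T γ) (B n) = 0
      rw [hmap, Measure.restrict_apply (hBm n), Set.inter_compl_self, measure_empty]
    refine hres.measure_image_dualRestrict_ne_zero hAdense (hν := hν) ?_ hV hνV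
    have ha1 : a.toReal < 1 := by
      rw [← ENNReal.toReal_one]
      exact (ENNReal.toReal_lt_toReal ha.ne_top ENNReal.one_ne_top).2 ha
    refine koopman_hasAlmostInvariantVectors _ hψ ν hν m hmν (c := 1 - a.toReal) (by linarith)
      (hfreq.mono fun n hn => ?_) (fun γ => ?_)
      fun b => tendsto_setIntegral_norm_char_sub_one_sq hμ b _
    · rw [measureReal_restrict_apply_univ, probReal_compl_eq_one_sub (hBm n)]
      have : (μ n : Measure (PontryaginDual (DiscreteCopy A))).real (B n) ≤ a.toReal := by
        rw [Measure.real, hμB]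
        exact ENNReal.toReal_mono ha.ne_top hn
      linarith
    · refine squeeze_zero (fun n => ?_) (fun n => ?_) (hμinv γ)
      · exact (norm_nonneg _).trans
          (le_measureNormDist _ _ (f := fun _ => 0) measurable_const (by simp))
      · change measureNormDist ((m n).map (T γ)) (m n) ≤ _
        rw [hmap]
        have : IsFiniteMeasure ((μ n : Measure (PontryaginDual (DiscreteCopy A))).map (T γ)) :=
          inferInstance
        exact measureNormDist_restrict_le _ _ (hBm n).compl
  exact ⟨key, tendsto_of_tendsto_of_tendsto_of_le_of_le key tendsto_const_nhds
    (fun n => measure_mono (Set.image_subset_range _ _)) fun n => prob_le_one⟩
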